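/- **Setting.** Let $k=\mathbb F_q$ be a finite field and let $\psi:k\to\mathbb C^*$ be a fixed non-trivial additive character. *Filtered spaces.* A filtered space $(I,F,V)$ is a $k$-vector space $V$ with a partially ordered set $I$, any two elements of which have a common lower and a common upper bound, and subspaces $F(i)\subset V$ with $F(i)\subset F(j)$ for $i\le j$, $\bigcap_i F(i)=0$, $\bigcup_i F(i)=V$. It is complete if $V=\varinjlim_i\varprojlim_{j\le i}F(i)/F(j)$. A filtration $(I,F,V)$ dominates $(J,G,V)$ through an order-preserving map $\varphi:J\to I$ if $F(\varphi(i))=G(i)$ for all $i\in J$ and for each $j\in I$ there are $i_1,i_2\in J$ with $\varphi(i_1)\le j\le\varphi(i_2)$. *$C_1$-spaces.* A $C_1$-space is a filtered space $E=(I,F,V)$ with all $F(j)/F(i)$, $i\le j$, finite-dimensional. It is compact if some $F(i)=V$, and discrete if some $F(i)=0$. Its dual is $\check E=(I^0,F^0,\check V)$, where $I^0$ is $I$ with the inverse order, $\check V=\bigcup_i F(i)^\perp\subset V^*$, $F^0(i)=F(i)^\perp$. A triple $0\to E_1\xrightarrow{\alpha}E_2\xrightarrow{\beta}E_3\to0$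 is admissible if it is exact on vector spaces, and the filtrations of $E_1$ and $E_3$ dominate the filtrations $F_2(i)\cap V_1$ and $\beta(F_2(i))$ ($i\in I_2$). $\mathcal D(E)$ is the space of functions $V\to\mathbb C$ supported in some $F(j)$ and invariant under translations by some $F(i)$, and $\mu(E)$ is the one-dimensional space of translation-invariant linear functionals on $\mathcal D(E)$. For an admissible triple there are the restriction $\alpha^*:\mathcal D(E_2)\to\mathcal D(E_1)$, the integration over the fibres $\beta_*:\mathcal D(E_2)\otimes\mu(E_1)\to\mathcal D(E_3)$, the product $\mu(E_1)\otimes\mu(E_3)=\mu(E_2)$ and, if $E_3$ is discrete, the extension by zero $\alpha_*:\mathcal D(E_1)\to\mathcal D(E_2)$. The Fourier transform $\mathbf F:\mathcal D(E)\otimes\mu(E)\to\mathcal D(\check E)$ is $\mathbf F(f\otimes\mu)(w)=\int_V f(v)\overline{\psi(w(v))}\,d\mu(v)$. *$C_2$-spaces.* A $C_2$-space is a filtered space $E=(I,F,V)$ with a structure of $C_1$-space on each $F(j)/F(i)$, $i\le j$, such that the triples $0\to F(j)/F(i)\to F(k)/F(i)\to F(k)/F(j)\to0$, $i\le j\le k$,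 are admissible. It is complete if $(I,F,V)$ and all the $C_1$-spaces $F(j)/F(i)$ are complete; it is a $cfC_2$-space (a $dfC_2$-space) if all the $F(j)/F(i)$ are compact (discrete). The dual $\check E=(I^0,F^0,\check V)$ is the $C_2$-space whose $C_1$-spaces are $F^0(j)/F^0(i)=(F(i)/F(j))\check{\ }$ for $j\le i$ in $I$. A triple $0\to E_1\xrightarrow{\alpha}E_2\xrightarrow{\beta}E_3\to0$ of $C_2$-spaces, $E_s=(I_s,F_s,V_s)$, is admissible if it is exact on vector spaces, there are order-preserving $\varepsilon:I_2\to I_1$ and $\gamma:I_2\to I_3$ through which the filtrations of $E_1$ and $E_3$ dominate the filtrations $F_2(i)\cap V_1=F_1(\varepsilon(i))$ and $\beta(F_2(i))=F_3(\gamma(i))$, and the triples $0\to F_1(\varepsilon(j))/F_1(\varepsilon(i))\to F_2(j)/F_2(i)\to F_3(\gamma(j))/F_3(\gamma(i))\to0$, $i\le j$ in $I_2$, are admissible. The dual triple $0\to\check E_3\to\check E_2\to\check E_1\to0$ is then admissible, with the maps $\gamma$ and $\varepsilon$. *Virtual measures and $\mathcal D_{F(o)}(E)$.* For a $C_2$-space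 $E$ and $i,j\in I$ let $\mu(F(i)\mid F(j))=\varinjlim_{l\le i,\,l\le j}\operatorname{Hom}_{\mathbb C}\big(\mu(F(i)/F(l)),\mu(F(j)/F(l))\big)$, a one-dimensional space; the transition maps $f\mapsto f'$, $f'(c\otimes a)=c\otimes f(a)$ for $l'\le l$, $c\in\mu(F(l)/F(l'))$, are isomorphisms. There are canonical isomorphisms $\mu(F(j)/F(l))\otimes\mu(F(j)\mid F(o))=\mu(F(l)\mid F(o))$ for $l\le j$, and $\mu(F(l)\mid F(n))=\mu(F^0(l)\mid F^0(n))$. For $o\in I$ put $$\mathcal D_{F(o)}(E)=\varprojlim_{l\le i}\ \mathcal D(F(i)/F(l))\otimes_{\mathbb C}\mu(F(l)\mid F(o)),$$ with respect to the maps $\alpha^*\otimes\mathrm{id}$ and $\beta_*\otimes\mathrm{id}$ for $l\le j\le i$. The two-dimensional Fourier transform $\mathbf F:\mathcal D_{F(o)}(E)\to\mathcal D_{F^0(o)}(\check E)$ is given by the maps $$\mathbf F\otimes\mathrm{id}:\ \mathcal D(F(i)/F(j))\otimes\mu(F(i)/F(j))\otimes\mu(F(i)\mid F(o))\to\mathcal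 D(F^0(j)/F^0(i))\otimes\mu(F^0(i)\mid F^0(o)),\qquad j\le i .$$ *The element $\delta_{E_1}$.* If $E$ is a $cfC_2$-space, the measures of total mass $1$ on the $F(i)/F(j)$ give canonical elements $1_{kl}\in\mu(F(k)\mid F(l))$, namely the virtual measures that preserve the total mass, and $\mathbf 1\in\mathcal D_{F(o)}(E)$ is the element with the components $1\otimes1_{lo}$. If $E$ is a $dfC_2$-space, the measures with $\{0\}$ of mass $1$ give canonical elements $\delta_{kl}\in\mu(F(k)\mid F(l))$, which preserve the mass of $\{0\}$. Let an admissible triple of $C_2$-spaces as above be given, with $E_1$ a $cfC_2$-space and $E_3$ a $dfC_2$-space, and let $o\in I_2$. The direct image $\alpha_*:\mathcal D_{F_1(\varepsilon(o))}(E_1)\to\mathcal D_{F_2(o)}(E_2)$ is given by the extension by zero $\mathcal D(F_1(\varepsilon(i))/F_1(\varepsilon(l)))\to\mathcal D(F_2(i)/F_2(l))$, tensored with the map $\mu(F_1(\varepsilon(l))\mid F_1(\varepsilon(o)))\to\mu(F_2(l)\mid F_2(o))$, $m\mapsto m\otimes\delta_{\gamma(l)\gamma(o)}$, where $\mu(F_1(\varepsilon(l))\mid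 F_1(\varepsilon(o)))\otimes\mu(F_3(\gamma(l))\mid F_3(\gamma(o)))=\mu(F_2(l)\mid F_2(o))$. Put $\delta_{E_1}=\alpha_*(\mathbf 1)$. This involves no choice of measures. Since $\check E_3$ is a $cfC_2$-space and $\check E_1$ is a $dfC_2$-space, the dual triple gives in the same way an element $\delta_{\check E_3}$ for $o\in I_2^0$. **Theorem (Poisson formula II).** Let $0\to E_1\xrightarrow{\alpha}E_2\xrightarrow{\beta}E_3\to0$ be an admissible triple of complete $C_2$-spaces over $\mathbb F_q$, where $E_1$ is a $cfC_2$-space and $E_3$ is a $dfC_2$-space. Let $o\in I_2$. Then $\mathbf 1\in\mathcal D_{F_1(\varepsilon(o))}(E_1)$, so that $\delta_{E_1}=\alpha_*(\mathbf 1)$ is defined; $\delta_{E_1}\in\mathcal D_{F_2(o)}(E_2)$; $\delta_{\check E_3}\in\mathcal D_{F_2^0(o)}(\check E_2)$; and $$\mathbf F(\delta_{E_1})=\delta_{\check E_3}.$$ -/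

import Mathlib

open scoped TensorProduct

universe u

noncomputable section

/-! ## Filtered spaces and `C₁`-spaces -/

/-- A filtered `K`-vector space `(I, F, V)`. -/
structure Filtration (K V : Type u) [Field K] [AddCommGroup V] [Module K V] where
  I : Type u
  [ord : PartialOrder I]
  F : I → Submodule K V
  mono : Monotone F
  directed : ∀ i j : I, ∃ k l : I, k ≤ i ∧ k ≤ j ∧ i ≤ l ∧ j ≤ l
  iInf_eq : ⨅ i, F i = ⊥
  exists_mem : ∀ v : V, ∃ i, v ∈ F i

attribute [instance] Filtration.ord

/-- The filtered space is complete: `V = lim_{→ i} lim_{← j ≤ i} F(i)/F(j)`. Since the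
intersection of the `F(j)` is `0` and their union is `V`, this says that each element of
`lim_{← j ≤ i} F(i)/F(j)`, represented by a compatible family `x j ∈ F(i)`, comes from `V`. -/
def Filtration.IsComplete {K V : Type u} [Field K] [AddCommGroup V] [Module K V]
    (E : Filtration K V) : Prop :=
  ∀ (i : E.I) (x : E.I → V), (∀ j, j ≤ i → x j ∈ E.F i) →
    (∀ j j', j' ≤ j → j ≤ i → x j' - x j ∈ E.F j) → ∃ v, ∀ j, j ≤ i → v - x j ∈ E.F j

/-- The filtration `(I, F, V)` dominates the filtration `(J, G, V)` through the
order-preserving function `φ : J → I`. -/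
def Filtration.DominatesVia {K V : Type u} [Field K] [AddCommGroup V] [Module K V]
    (E : Filtration K V) {J : Type u} [PartialOrder J] (G : J → Submodule K V)
    (φ : J →o E.I) : Prop :=
  (∀ i, E.F (φ i) = G i) ∧ ∀ j, ∃ i₁ i₂, φ i₁ ≤ j ∧ j ≤ φ i₂

/-- The subquotient `B/A` (of interest for `A ≤ B`). -/
abbrev SubQ {K V : Type u} [Field K] [AddCommGroup V] [Module K V] (A B : Submodule K V) :
    Type u :=
  B ⧸ A.submoduleOf B

theorem SubQ.finiteDimensional_of_ker_le {K V W : Type u} [Field K] [AddCommGroup V] [Module K V]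
    [AddCommGroup W] [Module K W] [FiniteDimensional K W] {A B : Submodule K V}
    (G : B →ₗ[K] W) (h : ∀ x, G x = 0 → x.1 ∈ A) : FiniteDimensional K (SubQ A B) := by
  have h1 : FiniteDimensional K (B ⧸ LinearMap.ker G) :=
    Module.Finite.equiv G.quotKerEquivRange.symm
  exact Module.Finite.of_surjective
    (Submodule.factor (p := LinearMap.ker G) (p' := A.submoduleOf B) (fun x hx => h x hx))
    (Submodule.factor_surjective _)

/-- The linear map `B/A → B'/A'` induced by a linear map `f` with `f(A) ⊆ A'`, `f(B) ⊆ B'`. -/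
def subQMap {K V W : Type u} [Field K] [AddCommGroup V] [Module K V] [AddCommGroup W]
    [Module K W] (f : V →ₗ[K] W) {A B : Submodule K V} {A' B' : Submodule K W}
    (hA : A ≤ A'.comap f) (hB : B ≤ B'.comap f) : SubQ A B →ₗ[K] SubQ A' B' :=
  Submodule.mapQ _ _ (f.restrict hB) (fun _ hx => hA hx)

/-- The structure of a `C₁`-space on the `K`-vector space `V`. -/
structure C1Str (K V : Type u) [Field K] [AddCommGroup V] [Module K V] extends
    Filtration K V where
  finite_quot : ∀ i j : I, i ≤ j → FiniteDimensional K (SubQ (F i) (F j))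

namespace C1Str

variable {K V V₁ V₂ V₃ : Type u} [Field K] [AddCommGroup V] [Module K V]
  [AddCommGroup V₁] [Module K V₁] [AddCommGroup V₂] [Module K V₂]
  [AddCommGroup V₃] [Module K V₃]

def IsCompact (E : C1Str K V) : Prop := ∃ i, E.F i = ⊤

def IsDiscrete (E : C1Str K V) : Prop := ∃ i, E.F i = ⊥

theorem exists_le (E : C1Str K V) (i j : E.I) : ∃ k, k ≤ i ∧ k ≤ j := by
  obtain ⟨k, _, h1, h2, _⟩ := E.directed i j
  exact ⟨k, h1, h2⟩

theorem exists_ge (E : C1Str K V) (i j : E.I) : ∃ k, i ≤ k ∧ j ≤ k := by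
  obtain ⟨_, k, _, _, h1, h2⟩ := E.directed i j
  exact ⟨k, h1, h2⟩

/-- `0 → E₁ → E₂ → E₃ → 0` is an admissible triple of `C₁`-spaces. (The exactness of the triples
of finite-dimensional quotients is a consequence of these conditions.) -/
structure IsAdmissible (E₁ : C1Str K V₁) (E₂ : C1Str K V₂) (E₃ : C1Str K V₃)
    (α : V₁ →ₗ[K] V₂) (β : V₂ →ₗ[K] V₃) : Prop where
  inj : Function.Injective α
  exact : Function.Exact α β
  surj : Function.Surjective β
  dom₁ : ∃ ε : E₂.I →o E₁.I, E₁.DominatesVia (fun i => (E₂.F i).comap α) ε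
  dom₃ : ∃ γ : E₂.I →o E₃.I, E₃.DominatesVia (fun i => (E₂.F i).map β) γ

/-! ### Dual `C₁`-spaces -/

/-- The space `V̌ = ⋃ F(i)^⊥` inside the dual space of `V`. -/
def dualSpace (E : C1Str K V) : Submodule K (Module.Dual K V) where
  carrier := {w | ∃ i, w ∈ (E.F i).dualAnnihilator}
  zero_mem' := by
    obtain ⟨i, _⟩ := E.exists_mem 0
    exact ⟨i, Submodule.zero_mem _⟩
  add_mem' := by
    rintro a b ⟨i, hi⟩ ⟨j, hj⟩
    obtain ⟨k, hki, hkj⟩ := E.exists_le i j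
    exact ⟨k, Submodule.add_mem _ (Submodule.dualAnnihilator_anti (E.mono hki) hi)
      (Submodule.dualAnnihilator_anti (E.mono hkj) hj)⟩
  smul_mem' := by
    rintro c a ⟨i, hi⟩
    exact ⟨i, Submodule.smul_mem _ c hi⟩

/-- The dual `C₁`-space `Ě = (I⁰, F⁰, V̌)`, `F⁰(i) = F(i)^⊥`. -/
def dual (E : C1Str K V) : C1Str K E.dualSpace where
  I := E.Iᵒᵈ
  F i := (E.F (OrderDual.ofDual i)).dualAnnihilator.submoduleOf E.dualSpace
  mono := fun _ _ h => Submodule.comap_mono (Submodule.dualAnnihilator_anti (E.mono h))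
  directed := fun i j => by
    obtain ⟨k, l, h1, h2, h3, h4⟩ := E.directed (OrderDual.ofDual i) (OrderDual.ofDual j)
    exact ⟨OrderDual.toDual l, OrderDual.toDual k, h3, h4, h1, h2⟩
  iInf_eq := by
    rw [eq_bot_iff]
    intro w hw
    rw [Submodule.mem_iInf] at hw
    rw [Submodule.mem_bot]
    ext v
    obtain ⟨i, hi⟩ := E.exists_mem v
    exact (Submodule.mem_dualAnnihilator _).1 (hw (OrderDual.toDual i)) v hi
  exists_mem := fun w => by
    obtain ⟨i, hi⟩ := w.2
    exact ⟨OrderDual.toDual i, hi⟩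
  finite_quot := fun i j h => by
    have hfin := E.finite_quot (OrderDual.ofDual j) (OrderDual.ofDual i) h
    set A := E.F (OrderDual.ofDual j) with hA
    set B := E.F (OrderDual.ofDual i) with hB
    let G : ↥(A.dualAnnihilator.submoduleOf E.dualSpace) →ₗ[K] Module.Dual K (SubQ A B) :=
      { toFun := fun w => Submodule.liftQ _ ((w.1.1 : V →ₗ[K] K).comp B.subtype)
          (fun x hx => (Submodule.mem_dualAnnihilator _).1 w.2 x.1 hx)
        map_add' := fun w w' => by
          apply Submodule.linearMap_qext
          ext x
          rfl
        map_smul' := fun c w => by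
          apply Submodule.linearMap_qext
          ext x
          rfl }
    refine SubQ.finiteDimensional_of_ker_le G fun w hw => ?_
    refine (Submodule.mem_dualAnnihilator w.1.1).2 fun x hx => ?_
    exact LinearMap.congr_fun hw (Submodule.Quotient.mk ⟨x, hx⟩)

theorem mem_dual_F (E : C1Str K V) (i : E.I) (w : E.dualSpace) :
    w ∈ E.dual.F (OrderDual.toDual i) ↔ ∀ x ∈ E.F i, w.1 x = 0 :=
  Submodule.mem_dualAnnihilator _

theorem IsCompact.dual {E : C1Str K V} (h : E.IsCompact) : E.dual.IsDiscrete := by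
  obtain ⟨i, hi⟩ := h
  refine ⟨OrderDual.toDual i, ?_⟩
  rw [eq_bot_iff]
  intro w hw
  rw [mem_dual_F, hi] at hw
  rw [Submodule.mem_bot]
  ext v
  exact hw v trivial

theorem IsDiscrete.dual {E : C1Str K V} (h : E.IsDiscrete) : E.dual.IsCompact := by
  obtain ⟨i, hi⟩ := h
  refine ⟨OrderDual.toDual i, ?_⟩
  rw [eq_top_iff]
  intro w _
  rw [mem_dual_F, hi]
  intro x hx
  rw [(Submodule.mem_bot K).1 hx, map_zero]

/-- `θ` is a morphism of `C₁`-spaces. -/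
def IsMor (E₁ : C1Str K V₁) (E₂ : C1Str K V₂) (θ : V₁ →ₗ[K] V₂) : Prop :=
  ∀ j, ∃ i, E₁.F i ≤ (E₂.F j).comap θ

/-- The morphism `θ̌` dual to a morphism `θ` of `C₁`-spaces. -/
def dualMap {E₁ : C1Str K V₁} {E₂ : C1Str K V₂} {θ : V₁ →ₗ[K] V₂} (h : IsMor E₁ E₂ θ) :
    E₂.dualSpace →ₗ[K] E₁.dualSpace :=
  θ.dualMap.restrict (by
    rintro w ⟨j, hj⟩
    obtain ⟨i, hi⟩ := h j
    refine ⟨i, (Submodule.mem_dualAnnihilator _).2 fun x hx => ?_⟩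
    exact (Submodule.mem_dualAnnihilator _).1 hj _ (hi hx))

theorem dualMap_apply {E₁ : C1Str K V₁} {E₂ : C1Str K V₂} {θ : V₁ →ₗ[K] V₂}
    (h : IsMor E₁ E₂ θ) (w : E₂.dualSpace) (x : V₁) : (dualMap h w).1 x = w.1 (θ x) := rfl

section Triple

variable {E₁ : C1Str K V₁} {E₂ : C1Str K V₂} {E₃ : C1Str K V₃}
  {α : V₁ →ₗ[K] V₂} {β : V₂ →ₗ[K] V₃}

theorem IsAdmissible.isMor_left (h : IsAdmissible E₁ E₂ E₃ α β) : IsMor E₁ E₂ α := by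
  obtain ⟨ε, hε, _⟩ := h.dom₁
  exact fun j => ⟨ε j, (hε j).le⟩

theorem IsAdmissible.isMor_right (h : IsAdmissible E₁ E₂ E₃ α β) : IsMor E₂ E₃ β := by
  obtain ⟨γ, hγ, hc⟩ := h.dom₃
  intro j
  obtain ⟨i, _, hi, _⟩ := hc j
  refine ⟨i, Submodule.map_le_iff_le_comap.1 ?_⟩
  exact (hγ i).ge.trans (E₃.mono hi)

theorem IsAdmissible.exists_extension (h : IsAdmissible E₁ E₂ E₃ α β) (i : E₂.I)
    (u : Module.Dual K V₁) (hu : ∀ x, α x ∈ E₂.F i → u x = 0) :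
    ∃ w : E₂.dual.F (OrderDual.toDual i), dualMap h.isMor_left w.1 = u := by
  have hmem : u ∈ LinearMap.range ((E₂.F i).mkQ.comp α).dualMap := by
    rw [LinearMap.range_dualMap_eq_dualAnnihilator_ker, Submodule.mem_dualAnnihilator]
    intro x hx
    apply hu
    simpa using hx
  obtain ⟨w, hw⟩ := hmem
  have hw' : w.comp (E₂.F i).mkQ ∈ (E₂.F i).dualAnnihilator := by
    rw [Submodule.mem_dualAnnihilator]
    intro x hx
    have : (E₂.F i).mkQ x = 0 := by simpa using hx
    simp [this]
  exact ⟨⟨⟨w.comp (E₂.F i).mkQ, i, hw'⟩, hw'⟩, hw⟩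

/-- The triple dual to an admissible triple is admissible. -/
theorem IsAdmissible.dual (h : IsAdmissible E₁ E₂ E₃ α β) :
    IsAdmissible E₃.dual E₂.dual E₁.dual (dualMap h.isMor_right) (dualMap h.isMor_left) where
  inj := by
    intro u v huv
    ext x
    obtain ⟨y, rfl⟩ := h.surj x
    have := congrArg (fun w : E₂.dualSpace => w.1 y) huv
    exact this
  exact := by
    intro w
    constructor
    · intro hw
      have hmem : w.1 ∈ LinearMap.range β.dualMap := by
        rw [LinearMap.range_dualMap_eq_dualAnnihilator_ker, Submodule.mem_dualAnnihilator]
        intro x hx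
        obtain ⟨y, rfl⟩ := (h.exact x).1 hx
        have := congrArg (fun w : E₁.dualSpace => w.1 y) hw
        exact this
      obtain ⟨u, hu⟩ := hmem
      obtain ⟨i, hi⟩ := w.2
      obtain ⟨γ, hγ, _⟩ := h.dom₃
      refine ⟨⟨u, γ i, ?_⟩, Subtype.ext hu⟩
      rw [Submodule.mem_dualAnnihilator, hγ]
      rintro _ ⟨y, hy, rfl⟩
      have h1 := (Submodule.mem_dualAnnihilator _).1 hi y hy
      rw [← hu] at h1
      exact h1
    · rintro ⟨u, rfl⟩
      ext x
      have h1 : β (α x) = 0 := (h.exact (α x)).2 ⟨x, rfl⟩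
      change u.1 (β (α x)) = 0
      rw [h1, map_zero]
  surj := by
    intro u
    obtain ⟨j, hj⟩ := u.2
    obtain ⟨ε, hε, hc⟩ := h.dom₁
    obtain ⟨i, _, hi, _⟩ := hc j
    obtain ⟨w, hw⟩ := h.exists_extension i u.1 (fun x hx =>
      (Submodule.mem_dualAnnihilator _).1 hj x (E₁.mono hi (by rw [hε]; exact hx)))
    exact ⟨w.1, Subtype.ext hw⟩
  dom₁ := by
    obtain ⟨γ, hγ, hc⟩ := h.dom₃
    refine ⟨γ.dual, ?_, ?_⟩
    · intro (i : E₂.Iᵒᵈ)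
      ext u
      refine (mem_dual_F E₃ (γ (OrderDual.ofDual i)) u).trans
        (Iff.trans ?_ (mem_dual_F E₂ (OrderDual.ofDual i) _).symm)
      rw [hγ]
      simp [dualMap_apply]
    · intro (j : E₃.Iᵒᵈ)
      obtain ⟨i₁, i₂, h₁, h₂⟩ := hc (OrderDual.ofDual j)
      exact ⟨OrderDual.toDual i₂, OrderDual.toDual i₁, h₂, h₁⟩
  dom₃ := by
    obtain ⟨ε, hε, hc⟩ := h.dom₁
    refine ⟨ε.dual, ?_, ?_⟩
    · intro (i : E₂.Iᵒᵈ)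
      ext u
      refine (mem_dual_F E₁ (ε (OrderDual.ofDual i)) u).trans ?_
      rw [hε]
      constructor
      · intro hu
        obtain ⟨w, hw⟩ := h.exists_extension (OrderDual.ofDual i) u.1 hu
        exact ⟨w.1, w.2, Subtype.ext hw⟩
      · rintro ⟨w, hw, rfl⟩ x hx
        exact (mem_dual_F E₂ (OrderDual.ofDual i) w).1 hw _ hx
    · intro (j : E₁.Iᵒᵈ)
      obtain ⟨i₁, i₂, h₁, h₂⟩ := hc (OrderDual.ofDual j)
      exact ⟨OrderDual.toDual i₂, OrderDual.toDual i₁, h₂, h₁⟩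

end Triple

end C1Str

namespace C1Str

variable {K V V₁ V₂ V₃ : Type u} [Field K] [AddCommGroup V] [Module K V]
  [AddCommGroup V₁] [Module K V₁] [AddCommGroup V₂] [Module K V₂]
  [AddCommGroup V₃] [Module K V₃]

/-! ### Functions and invariant measures on `C₁`-spaces -/

/-- The space `D(E)` of locally constant functions with compact support: the complex functions
on `V` supported in some `F(j)` and invariant under translations by some `F(i)`. -/
def D (E : C1Str K V) : Submodule ℂ (V → ℂ) where
  carrier := {f | ∃ i j, i ≤ j ∧ (∀ v, v ∉ E.F j → f v = 0) ∧
    ∀ w ∈ E.F i, ∀ v, f (v + w) = f v}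
  zero_mem' := by
    obtain ⟨i, _⟩ := E.exists_mem 0
    exact ⟨i, i, le_rfl, fun _ _ => rfl, fun _ _ _ => rfl⟩
  add_mem' := by
    rintro f g ⟨i, j, hij, hf, hf'⟩ ⟨k, l, hkl, hg, hg'⟩
    obtain ⟨a, hai, hak⟩ := E.exists_le i k
    obtain ⟨b, hjb, hlb⟩ := E.exists_ge j l
    refine ⟨a, b, hai.trans (hij.trans hjb), fun v hv => ?_, fun w hw v => ?_⟩
    · simp [hf v fun h => hv (E.mono hjb h), hg v fun h => hv (E.mono hlb h)]
    · simp [hf' w (E.mono hai hw) v, hg' w (E.mono hak hw) v]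
  smul_mem' := by
    rintro c f ⟨i, j, hij, hf, hf'⟩
    refine ⟨i, j, hij, fun v hv => ?_, fun w hw v => ?_⟩
    · simp [hf v hv]
    · simp [hf' w hw v]

theorem mem_D_of (E : C1Str K V) {f : V → ℂ} (i j : E.I) (hf : ∀ v, v ∉ E.F j → f v = 0)
    (hf' : ∀ w ∈ E.F i, ∀ v, f (v + w) = f v) : f ∈ E.D := by
  obtain ⟨k, hki, hkj⟩ := E.exists_le i j
  exact ⟨k, j, hkj, hf, fun w hw => hf' w (E.mono hki hw)⟩

/-- The translation `T_a(f)(v) = f(v + a)` on `D(E)`. -/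
def translate (E : C1Str K V) (a : V) : E.D →ₗ[ℂ] E.D where
  toFun f := ⟨fun v => f.1 (v + a), by
    obtain ⟨i, j, _, hf, hf'⟩ := f.2
    obtain ⟨k, hk⟩ := E.exists_mem a
    obtain ⟨l, hjl, hkl⟩ := E.exists_ge j k
    refine E.mem_D_of i l (fun v hv => hf _ fun h => hv ?_) fun w hw v => ?_
    · have := (E.F l).sub_mem (E.mono hjl h) (E.mono hkl hk)
      rwa [add_sub_cancel_right] at this
    · rw [add_right_comm, hf' w hw]⟩
  map_add' _ _ := rfl
  map_smul' _ _ := rfl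

/-- The space `μ(E)` of invariant measures on `E`: the distributions, that is, the linear
functionals on `D(E)`, that are invariant under all translations. -/
def mu (E : C1Str K V) : Submodule ℂ (Module.Dual ℂ E.D) where
  carrier := {G | ∀ a f, G (E.translate a f) = G f}
  zero_mem' := fun _ _ => rfl
  add_mem' := fun {G G'} h h' a f => by
    rw [LinearMap.add_apply, LinearMap.add_apply, h, h']
  smul_mem' := fun c G h a f => by
    rw [LinearMap.smul_apply, LinearMap.smul_apply, h]

/-- The characteristic function `δ_{F(i)}` of `F(i)`. -/
def charFun (E : C1Str K V) (i : E.I) : E.D :=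
  ⟨Set.indicator (E.F i : Set V) 1,
    E.mem_D_of i i (fun _ hv => Set.indicator_of_notMem hv _) fun w hw v => by
      classical
      simp only [Set.indicator_apply, SetLike.mem_coe, (E.F i).add_mem_iff_left hw,
        Pi.one_apply]⟩

/-- `μ(F(i)) = μ(δ_{F(i)})`. -/
def mass {E : C1Str K V} (m : E.mu) (i : E.I) : ℂ := m.1 (E.charFun i)

/-- The function `1 ∈ D(E)` on a compact `C₁`-space. -/
def one (E : C1Str K V) (h : E.IsCompact) : E.D :=
  ⟨fun _ => 1, by
    obtain ⟨i, hi⟩ := h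
    exact E.mem_D_of i i (fun v hv => (hv (by rw [hi]; trivial)).elim) fun _ _ _ => rfl⟩

/-- The function `δ₀ ∈ D(E)` on a discrete `C₁`-space: `δ₀(0) = 1` and `δ₀(v) = 0` for `v ≠ 0`. -/
def deltaZero (E : C1Str K V) (h : E.IsDiscrete) : E.D :=
  ⟨Set.indicator {0} 1, by
    obtain ⟨i, hi⟩ := h
    refine E.mem_D_of i i (fun v hv => Set.indicator_of_notMem (fun h => hv ?_) _)
      fun w hw v => ?_
    · rw [Set.mem_singleton_iff.1 h]
      exact Submodule.zero_mem _
    · rw [hi, Submodule.mem_bot] at hw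
      rw [hw, add_zero]⟩

section Triple

variable {E₁ : C1Str K V₁} {E₂ : C1Str K V₂} {E₃ : C1Str K V₃}
  {α : V₁ →ₗ[K] V₂} {β : V₂ →ₗ[K] V₃}

/-- The inverse image `α^* : D(E₂) → D(E₁)`, `α^*(f)(v) = f(α(v))`. -/
def pull (h : IsAdmissible E₁ E₂ E₃ α β) : E₂.D →ₗ[ℂ] E₁.D where
  toFun f := ⟨fun v => f.1 (α v), by
    obtain ⟨i, j, _, hf, hf'⟩ := f.2
    obtain ⟨ε, hε, _⟩ := h.dom₁
    refine E₁.mem_D_of (ε i) (ε j) (fun v hv => hf _ fun h => hv ?_) fun w hw v => ?_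
    · rw [hε]; exact h
    · rw [hε] at hw
      rw [map_add, hf' _ hw]⟩
  map_add' _ _ := rfl
  map_smul' _ _ := rfl

theorem pull_translate (h : IsAdmissible E₁ E₂ E₃ α β) (v : V₁) (f : E₂.D) :
    pull h (E₂.translate (α v) f) = E₁.translate v (pull h f) := by
  ext x
  change f.1 (α x + α v) = f.1 (α (x + v))
  rw [map_add]

theorem integral_fibre_eq (h : IsAdmissible E₁ E₂ E₃ α β) (m : E₁.mu) (f : E₂.D) {x y : V₂}
    (hxy : β x = β y) :
    m.1 (pull h (E₂.translate x f)) = m.1 (pull h (E₂.translate y f)) := by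
  obtain ⟨v, hv⟩ := (h.exact (x - y)).1 (by rw [map_sub, hxy, sub_self])
  have h1 : E₂.translate x f = E₂.translate (α v) (E₂.translate y f) := by
    ext z
    change f.1 (z + x) = f.1 (z + α v + y)
    rw [hv]
    abel_nf
  rw [h1, pull_translate, m.2]

/-- The direct image `β_* : D(E₂) ⊗ μ(E₁) → D(E₃)` (integration over the fibres),
`β_*(f ⊗ μ₁)(w) = ∫_{V₁} T_{w'}(f) dμ₁` for any `w'` with `β(w') = w`. -/
def push (h : IsAdmissible E₁ E₂ E₃ α β) : E₁.mu →ₗ[ℂ] E₂.D →ₗ[ℂ] E₃.D :=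
  LinearMap.mk₂ ℂ
    (fun m f => ⟨fun w => m.1 (pull h (E₂.translate (Function.surjInv h.surj w) f)), by
      obtain ⟨i, j, _, hf, hf'⟩ := f.2
      obtain ⟨γ, hγ, _⟩ := h.dom₃
      refine E₃.mem_D_of (γ i) (γ j) (fun w hw => ?_) fun w hw v => ?_
      · have h0 : pull h (E₂.translate (Function.surjInv h.surj w) f) = 0 := by
          ext v
          apply hf
          intro hv
          apply hw
          rw [hγ]
          refine ⟨_, hv, ?_⟩
          rw [map_add, (h.exact (α v)).2 ⟨v, rfl⟩, zero_add]
          exact Function.surjInv_eq h.surj w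
        rw [h0, map_zero]
      · rw [hγ] at hw
        obtain ⟨y, hy, rfl⟩ := hw
        have h1 : β (Function.surjInv h.surj (v + β y)) =
            β (Function.surjInv h.surj v + y) := by
          rw [map_add, Function.surjInv_eq h.surj, Function.surjInv_eq h.surj]
        rw [integral_fibre_eq h m f h1]
        congr 2
        ext z
        change f.1 (z + (_ + y)) = f.1 (z + _)
        rw [← add_assoc, hf' y hy]⟩)
    (fun _ _ _ => rfl) (fun _ _ _ => rfl)
    (fun m f g => by
      ext w
      change m.1 (pull h (E₂.translate _ (f + g))) = _
      rw [map_add, map_add, map_add]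
      rfl)
    (fun c m f => by
      ext w
      change m.1 (pull h (E₂.translate _ (c • f))) = _
      rw [map_smul, map_smul, map_smul]
      rfl)

theorem push_apply (h : IsAdmissible E₁ E₂ E₃ α β) (m : E₁.mu) (f : E₂.D) (x : V₂) :
    (push h m f).1 (β x) = m.1 (pull h (E₂.translate x f)) :=
  integral_fibre_eq h m f (Function.surjInv_eq h.surj _)

theorem push_translate (h : IsAdmissible E₁ E₂ E₃ α β) (m : E₁.mu) (f : E₂.D) (a : V₂) :
    push h m (E₂.translate a f) = E₃.translate (β a) (push h m f) := by
  ext w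
  obtain ⟨x, rfl⟩ := h.surj w
  change (push h m (E₂.translate a f)).1 (β x) = (push h m f).1 (β x + β a)
  rw [← map_add, push_apply, push_apply]
  congr 2
  ext z
  change f.1 (z + x + a) = f.1 (z + (x + a))
  rw [add_assoc]

/-- The product of measures `μ(E₁) ⊗ μ(E₃) → μ(E₂)`,
`∫ f d(μ₁ ⊗ μ₃) = ∫ β_*(f ⊗ μ₁) dμ₃`. -/
def prod (h : IsAdmissible E₁ E₂ E₃ α β) : E₁.mu →ₗ[ℂ] E₃.mu →ₗ[ℂ] E₂.mu :=
  LinearMap.mk₂ ℂ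
    (fun m₁ m₃ => ⟨m₃.1.comp (push h m₁), fun a f => by
      rw [LinearMap.comp_apply, push_translate, m₃.2]
      rfl⟩)
    (fun m m' n => by
      ext f
      change n.1 (push h (m + m') f) = _
      rw [map_add, LinearMap.add_apply, map_add]
      rfl)
    (fun c m n => by
      ext f
      change n.1 (push h (c • m) f) = _
      rw [map_smul, LinearMap.smul_apply, map_smul]
      rfl)
    (fun _ _ _ => rfl) (fun _ _ _ => rfl)

theorem prod_apply (h : IsAdmissible E₁ E₂ E₃ α β) (m₁ : E₁.mu) (m₃ : E₃.mu) (f : E₂.D) :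
    (prod h m₁ m₃).1 f = m₃.1 (push h m₁ f) := rfl

/-- The product of measures in terms of the volumes of the members of the filtration:
`(μ₁ ⊗ μ₃)(F₂(j)) = μ₁(F₂(j) ∩ V₁) μ₃(β(F₂(j)))`. -/
theorem mass_prod (h : IsAdmissible E₁ E₂ E₃ α β) (m₁ : E₁.mu) (m₃ : E₃.mu) (j : E₂.I)
    (j₁ : E₁.I) (j₃ : E₃.I) (h₁ : E₁.F j₁ = (E₂.F j).comap α) (h₃ : E₃.F j₃ = (E₂.F j).map β) :
    mass (prod h m₁ m₃) j = mass m₁ j₁ * mass m₃ j₃ := by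
  have h4 : push h m₁ (E₂.charFun j) = mass m₁ j₁ • E₃.charFun j₃ := by
    ext w
    change (push h m₁ (E₂.charFun j)).1 w = mass m₁ j₁ * (E₃.charFun j₃).1 w
    by_cases hw : w ∈ E₃.F j₃
    · have h5 : (E₃.charFun j₃).1 w = 1 := Set.indicator_of_mem hw _
      rw [h₃] at hw
      obtain ⟨y, hy, rfl⟩ := hw
      rw [push_apply, h5, mul_one]
      unfold mass
      congr 1
      ext v
      classical
      change Set.indicator (E₂.F j : Set V₂) 1 (α v + y) =
        Set.indicator (E₁.F j₁ : Set V₁) 1 v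
      simp only [Set.indicator_apply, SetLike.mem_coe, (E₂.F j).add_mem_iff_left hy, h₁,
        Submodule.mem_comap, Pi.one_apply]
    · have h5 : (E₃.charFun j₃).1 w = 0 := Set.indicator_of_notMem hw _
      obtain ⟨x, rfl⟩ := h.surj w
      rw [push_apply, h5, mul_zero]
      have h6 : pull h (E₂.translate x (E₂.charFun j)) = 0 := by
        ext v
        refine Set.indicator_of_notMem (fun hv => hw ?_) _
        rw [h₃]
        refine ⟨_, hv, ?_⟩
        rw [map_add, (h.exact (α v)).2 ⟨v, rfl⟩, zero_add]
      rw [h6, map_zero]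
  unfold mass
  rw [prod_apply, h4, map_smul]
  rfl

/-- The direct image `α_* : D(E₁) → D(E₂)` (extension by zero) when `E₃` is discrete. -/
def extendZero (h : IsAdmissible E₁ E₂ E₃ α β) (hd : E₃.IsDiscrete) : E₁.D →ₗ[ℂ] E₂.D where
  toFun f := ⟨Function.extend α f.1 0, by
    obtain ⟨i, j, _, hf, hf'⟩ := f.2
    obtain ⟨k, hk⟩ := hd
    obtain ⟨ε, hε, hεc⟩ := h.dom₁
    obtain ⟨γ, hγ, hγc⟩ := h.dom₃
    obtain ⟨i₁, _, hi₁, _⟩ := hεc i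
    obtain ⟨_, j₂, _, hj₂⟩ := hεc j
    obtain ⟨k₁, _, hk₁, _⟩ := hγc k
    obtain ⟨l, hl, hl'⟩ := E₂.exists_le i₁ k₁
    have hrange : ∀ x ∈ E₂.F l, ∃ y ∈ E₁.F i, α y = x := by
      intro x hx
      have h1 : β x ∈ E₃.F k := by
        apply E₃.mono hk₁
        rw [hγ]
        exact ⟨x, E₂.mono hl' hx, rfl⟩
      rw [hk, Submodule.mem_bot] at h1
      obtain ⟨y, rfl⟩ := (h.exact x).1 h1
      refine ⟨y, E₁.mono hi₁ ?_, rfl⟩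
      rw [hε]
      exact E₂.mono hl hx
    refine E₂.mem_D_of l j₂ (fun v hv => ?_) fun w hw v => ?_
    · by_cases hv' : ∃ y, α y = v
      · obtain ⟨y, rfl⟩ := hv'
        rw [h.inj.extend_apply]
        refine hf y fun hy => hv ?_
        have h2 := E₁.mono hj₂ hy
        rw [hε] at h2
        exact h2
      · rw [Function.extend_apply' _ _ _ hv']
        rfl
    · obtain ⟨y, hy, rfl⟩ := hrange w hw
      by_cases hv' : ∃ z, α z = v
      · obtain ⟨z, rfl⟩ := hv'
        rw [← map_add, h.inj.extend_apply, h.inj.extend_apply, hf' y hy]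
      · have hv'' : ¬ ∃ z, α z = v + α y := by
          rintro ⟨z, hz⟩
          exact hv' ⟨z - y, by rw [map_sub, hz, add_sub_cancel_right]⟩
        rw [Function.extend_apply' _ _ _ hv', Function.extend_apply' _ _ _ hv'']
        rfl⟩
  map_add' f g := by
    ext v
    change Function.extend α (f.1 + g.1) 0 v =
      Function.extend α f.1 0 v + Function.extend α g.1 0 v
    by_cases hv : ∃ y, α y = v
    · obtain ⟨y, rfl⟩ := hv
      simp only [h.inj.extend_apply, Pi.add_apply]
    · simp only [Function.extend_apply' _ _ _ hv, Pi.zero_apply, add_zero]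
  map_smul' c f := by
    ext v
    change Function.extend α (c • f.1) 0 v = c * Function.extend α f.1 0 v
    by_cases hv : ∃ y, α y = v
    · obtain ⟨y, rfl⟩ := hv
      simp only [h.inj.extend_apply, Pi.smul_apply, smul_eq_mul]
    · simp only [Function.extend_apply' _ _ _ hv, Pi.zero_apply, mul_zero]

end Triple

/-! ### The Fourier transform on `C₁`-spaces -/

/-- Multiplication of `f ∈ D(E)` by the function `v ↦ conj ψ(w(v))`, where `w ∈ V̌`. -/
def mulChar (ψ : AddChar K ℂ) (E : C1Str K V) (w : E.dualSpace) : E.D →ₗ[ℂ] E.D where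
  toFun f := ⟨fun v => f.1 v * starRingEnd ℂ (ψ (w.1 v)), by
    obtain ⟨i, j, _, hf, hf'⟩ := f.2
    obtain ⟨k, hk⟩ := w.2
    obtain ⟨l, hl, hl'⟩ := E.exists_le i k
    refine E.mem_D_of l j (fun v hv => ?_) fun x hx v => ?_
    · rw [hf v hv, zero_mul]
    · rw [hf' x (E.mono hl hx), map_add,
        (Submodule.mem_dualAnnihilator _).1 hk x (E.mono hl' hx), add_zero]⟩
  map_add' f g := by
    ext v
    exact add_mul _ _ _
  map_smul' c f := by
    ext v
    exact mul_assoc _ _ _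

/-- The Fourier transform `D(E) ⊗ μ(E) → D(Ě)`, `F(f ⊗ μ)(w) = ∫_V f(v) conj ψ(w(v)) dμ(v)`. -/
def fourier (ψ : AddChar K ℂ) (hψ : ψ ≠ 1) (E : C1Str K V) :
    E.D →ₗ[ℂ] E.mu →ₗ[ℂ] E.dual.D :=
  LinearMap.mk₂ ℂ
    (fun f m => ⟨fun w => m.1 (E.mulChar ψ w f), by
      obtain ⟨i, j, _, hf, hf'⟩ := f.2
      refine E.dual.mem_D_of (OrderDual.toDual j) (OrderDual.toDual i) (fun w hw => ?_)
        fun u hu w => ?_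
      · rw [mem_dual_F] at hw
        push Not at hw
        obtain ⟨x, hx, hwx⟩ := hw
        obtain ⟨c, hc⟩ : ∃ c, ψ c ≠ 1 := by
          by_contra hcon
          push Not at hcon
          exact hψ (DFunLike.ext _ _ hcon)
        have hy : (c / w.1 x) • x ∈ E.F i := Submodule.smul_mem _ _ hx
        have hwy : w.1 ((c / w.1 x) • x) = c := by
          rw [map_smul, smul_eq_mul, div_mul_cancel₀ _ hwx]
        set y := (c / w.1 x) • x
        have h1 : E.translate y (E.mulChar ψ w f) =
            starRingEnd ℂ (ψ c) • E.mulChar ψ w f := by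
          ext v
          change f.1 (v + y) * starRingEnd ℂ (ψ (w.1 (v + y))) =
            starRingEnd ℂ (ψ c) * (f.1 v * starRingEnd ℂ (ψ (w.1 v)))
          rw [hf' y hy, map_add, hwy, AddChar.map_add_eq_mul, map_mul]
          ring
        have h2 := m.2 y (E.mulChar ψ w f)
        rw [h1, map_smul, smul_eq_mul] at h2
        by_contra h3
        apply hc
        have h4 : starRingEnd ℂ (ψ c) = 1 :=
          mul_right_cancel₀ h3 (by rw [h2, one_mul])
        have h5 := congrArg (starRingEnd ℂ) h4
        rwa [Complex.conj_conj, map_one] at h5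
      · rw [mem_dual_F] at hu
        congr 1
        ext v
        change f.1 v * starRingEnd ℂ (ψ (w.1 v + u.1 v)) =
          f.1 v * starRingEnd ℂ (ψ (w.1 v))
        by_cases hv : v ∈ E.F j
        · rw [hu v hv, add_zero]
        · rw [hf v hv, zero_mul, zero_mul]⟩)
    (fun f g m => by
      ext w
      change m.1 (E.mulChar ψ w (f + g)) = _
      rw [map_add, map_add]
      rfl)
    (fun c f m => by
      ext w
      change m.1 (E.mulChar ψ w (c • f)) = _
      rw [map_smul, map_smul]
      rfl)
    (fun _ _ _ => rfl) (fun _ _ _ => rfl)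

end C1Str

/-! ## Systems of `C₁`-spaces -/

/-- The system of `C₁`-spaces `E_{i,j} = F(j)/F(i)`, `i ≤ j`, attached to a `C₂`-space, together
with the natural maps `E_{i,j} → E_{i,k} → E_{j,k}` for `i ≤ j ≤ k`. -/
structure C1System (K : Type u) [Field K] where
  I : Type u
  [ord : PartialOrder I]
  Q : ∀ {i j : I}, i ≤ j → Type u
  [acg : ∀ {i j : I} (h : i ≤ j), AddCommGroup (Q h)]
  [mod : ∀ {i j : I} (h : i ≤ j), Module K (Q h)]
  E : ∀ {i j : I} (h : i ≤ j), C1Str K (Q h)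
  ι : ∀ {i j k : I} (h : i ≤ j) (h' : j ≤ k), Q h →ₗ[K] Q (h.trans h')
  ρ : ∀ {i j k : I} (h : i ≤ j) (h' : j ≤ k), Q (h.trans h') →ₗ[K] Q h'
  adm : ∀ {i j k : I} (h : i ≤ j) (h' : j ≤ k),
    (E h).IsAdmissible (E (h.trans h')) (E h') (ι h h') (ρ h h')
  ι_ι : ∀ {i j k l : I} (h₁ : i ≤ j) (h₂ : j ≤ k) (h₃ : k ≤ l) (x : Q h₁),
    ι (h₁.trans h₂) h₃ (ι h₁ h₂ x) = ι h₁ (h₂.trans h₃) x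
  ρ_ρ : ∀ {i j k l : I} (h₁ : i ≤ j) (h₂ : j ≤ k) (h₃ : k ≤ l)
    (x : Q (h₁.trans (h₂.trans h₃))),
    ρ h₂ h₃ (ρ h₁ (h₂.trans h₃) x) = ρ (h₁.trans h₂) h₃ x
  ρ_ι : ∀ {i j k l : I} (h₁ : i ≤ j) (h₂ : j ≤ k) (h₃ : k ≤ l) (x : Q (h₁.trans h₂)),
    ρ h₁ (h₂.trans h₃) (ι (h₁.trans h₂) h₃ x) = ι h₂ h₃ (ρ h₁ h₂ x)

attribute [instance] C1System.ord C1System.acg C1System.mod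

/-- The inverse of a bijective linear map (and `0` if the map is not bijective). -/
def linInv {A B : Type*} [AddCommMonoid A] [Module ℂ A] [AddCommMonoid B]
    [Module ℂ B]
    (f : A →ₗ[ℂ] B) : B →ₗ[ℂ] A :=
  open Classical in
  if h : Function.Bijective f then (LinearEquiv.ofBijective f h).symm.toLinearMap else 0

/-- The linear map `A → B` whose graph is `R ⊆ A × B` (and `0` if `R` is not the graph of a
linear map `A → B`). -/
def ofGraph {A B : Type*} [AddCommMonoid A] [Module ℂ A] [AddCommMonoid B]
    [Module ℂ B]
    (R : Submodule ℂ (A × B)) : A →ₗ[ℂ] B :=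
  (LinearMap.snd ℂ A B ∘ₗ R.subtype) ∘ₗ linInv (LinearMap.fst ℂ A B ∘ₗ R.subtype)

namespace C1System

variable {K : Type u} [Field K]

/-- The dual system: the index set has the inverse order, and the `C₁`-space attached to
`F⁰(j)/F⁰(i)`, for `j ≤ i`, is the dual `Ě_{j,i}` of `E_{j,i} = F(i)/F(j)`. -/
def dual (S : C1System K) : C1System K where
  I := S.Iᵒᵈ
  Q h := (S.E (OrderDual.ofDual_le_ofDual.2 h)).dualSpace
  E h := (S.E (OrderDual.ofDual_le_ofDual.2 h)).dual
  ι h h' := C1Str.dualMap (S.adm (OrderDual.ofDual_le_ofDual.2 h')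
    (OrderDual.ofDual_le_ofDual.2 h)).isMor_right
  ρ h h' := C1Str.dualMap (S.adm (OrderDual.ofDual_le_ofDual.2 h')
    (OrderDual.ofDual_le_ofDual.2 h)).isMor_left
  adm h h' := (S.adm (OrderDual.ofDual_le_ofDual.2 h') (OrderDual.ofDual_le_ofDual.2 h)).dual
  ι_ι h₁ h₂ h₃ w := by
    ext x
    exact congrArg w.1 (S.ρ_ρ (OrderDual.ofDual_le_ofDual.2 h₃)
      (OrderDual.ofDual_le_ofDual.2 h₂) (OrderDual.ofDual_le_ofDual.2 h₁) x)
  ρ_ρ h₁ h₂ h₃ w := by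
    ext x
    exact congrArg w.1 (S.ι_ι (OrderDual.ofDual_le_ofDual.2 h₃)
      (OrderDual.ofDual_le_ofDual.2 h₂) (OrderDual.ofDual_le_ofDual.2 h₁) x)
  ρ_ι h₁ h₂ h₃ w := by
    ext x
    exact congrArg w.1 (S.ρ_ι (OrderDual.ofDual_le_ofDual.2 h₃)
      (OrderDual.ofDual_le_ofDual.2 h₂) (OrderDual.ofDual_le_ofDual.2 h₁) x)

/-- The element `i` as an element of the index set of the dual system. -/
abbrev op (S : C1System K) (i : S.I) : S.dual.I := OrderDual.toDual i

theorem op_le (S : C1System K) {i j : S.I} (h : i ≤ j) : S.op j ≤ S.op i := h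

/-! ### Virtual measures -/

/-- The product `μ(F(j)/F(i)) ⊗ μ(F(k)/F(j)) → μ(F(k)/F(i))` for `i ≤ j ≤ k`. -/
abbrev mprod (S : C1System K) {i j k : S.I} (h : i ≤ j) (h' : j ≤ k) :
    (S.E h).mu →ₗ[ℂ] (S.E h').mu →ₗ[ℂ] (S.E (h.trans h')).mu :=
  C1Str.prod (S.adm h h')

theorem push_mprod (S : C1System K) {i j k l : S.I} (h₁ : i ≤ j) (h₂ : j ≤ k) (h₃ : k ≤ l)
    (c : (S.E h₁).mu) (x : (S.E h₂).mu) (f : (S.E (h₁.trans (h₂.trans h₃))).D) :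
    C1Str.push (S.adm (h₁.trans h₂) h₃) (S.mprod h₁ h₂ c x) f =
      C1Str.push (S.adm h₂ h₃) x (C1Str.push (S.adm h₁ (h₂.trans h₃)) c f) := by
  ext w
  obtain ⟨y, rfl⟩ := (S.adm (h₁.trans h₂) h₃).surj w
  rw [C1Str.push_apply, C1Str.prod_apply, ← S.ρ_ρ h₁ h₂ h₃, C1Str.push_apply]
  congr 1
  ext z
  obtain ⟨z, rfl⟩ := (S.adm h₁ h₂).surj z
  rw [C1Str.push_apply]
  change _ = (C1Str.push (S.adm h₁ (h₂.trans h₃)) c f).1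
    (S.ι h₂ h₃ (S.ρ h₁ h₂ z) + S.ρ h₁ (h₂.trans h₃) y)
  rw [← S.ρ_ι, ← map_add, C1Str.push_apply]
  congr 1
  ext v
  change f.1 (S.ι (h₁.trans h₂) h₃ (S.ι h₁ h₂ v + z) + y) =
    f.1 (S.ι h₁ (h₂.trans h₃) v + (S.ι (h₁.trans h₂) h₃ z + y))
  rw [map_add, S.ι_ι, add_assoc]

/-- Associativity of the product of measures. -/
theorem mprod_assoc (S : C1System K) {i j k l : S.I} (h₁ : i ≤ j) (h₂ : j ≤ k) (h₃ : k ≤ l)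
    (c : (S.E h₁).mu) (x : (S.E h₂).mu) (a : (S.E h₃).mu) :
    S.mprod (h₁.trans h₂) h₃ (S.mprod h₁ h₂ c x) a =
      S.mprod h₁ (h₂.trans h₃) c (S.mprod h₂ h₃ x a) := by
  ext f
  exact congrArg a.1 (S.push_mprod h₁ h₂ h₃ c x f)

/-- The space of virtual measures `μ(F(i) | F(j))`: the limit over `l ≤ i, j` of the spaces
`Hom(μ(F(i)/F(l)), μ(F(j)/F(l)))`, along the isomorphisms sending the map at `l` to the map at
`l' ≤ l` given by `c ⊗ a ↦ c ⊗ φ_l(a)` for `c ∈ μ(F(l)/F(l'))`. (The transition maps of this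
filtered system are isomorphisms, so that its elements are the families
of corresponding maps.) -/
def vm (S : C1System K) (i j : S.I) : Submodule ℂ
    (∀ l : {l : S.I // l ≤ i ∧ l ≤ j}, (S.E l.2.1).mu →ₗ[ℂ] (S.E l.2.2).mu) where
  carrier := {φ | ∀ (l l' : {l : S.I // l ≤ i ∧ l ≤ j}) (h : l'.1 ≤ l.1) (c : (S.E h).mu)
    (a : (S.E l.2.1).mu), φ l' (S.mprod h l.2.1 c a) = S.mprod h l.2.2 c (φ l a)}
  zero_mem' := fun l _ h c _ => (LinearMap.map_zero (S.mprod h l.2.2 c)).symm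
  add_mem' := fun {φ φ'} hφ hφ' l l' h c a =>
    (congrArg₂ (· + ·) (hφ l l' h c a) (hφ' l l' h c a)).trans
      (LinearMap.map_add (S.mprod h l.2.2 c) (φ l a) (φ' l a)).symm
  smul_mem' := fun t φ hφ l l' h c a =>
    (congrArg (t • ·) (hφ l l' h c a)).trans
      (LinearMap.map_smul (S.mprod h l.2.2 c) t (φ l a)).symm

/-- The space of functions `D(F(j)/F(i))`. -/
def Fn (S : C1System K) {i j : S.I} (h : i ≤ j) : Type u := (S.E h).D

/-- The space of measures `μ(F(j)/F(i))`. -/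
def Ms (S : C1System K) {i j : S.I} (h : i ≤ j) : Type u := (S.E h).mu

/-- The space of virtual measures `μ(F(i) | F(j))`. -/
def VM (S : C1System K) (i j : S.I) : Type u := S.vm i j

instance (S : C1System K) {i j : S.I} (h : i ≤ j) : AddCommGroup (S.Fn h) :=
  inferInstanceAs (AddCommGroup (S.E h).D)

instance (S : C1System K) {i j : S.I} (h : i ≤ j) : Module ℂ (S.Fn h) :=
  inferInstanceAs (Module ℂ (S.E h).D)

instance (S : C1System K) {i j : S.I} (h : i ≤ j) : AddCommGroup (S.Ms h) :=
  inferInstanceAs (AddCommGroup (S.E h).mu)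

instance (S : C1System K) {i j : S.I} (h : i ≤ j) : Module ℂ (S.Ms h) :=
  inferInstanceAs (Module ℂ (S.E h).mu)

instance (S : C1System K) (i j : S.I) : AddCommMonoid (S.VM i j) :=
  inferInstanceAs (AddCommMonoid (S.vm i j))

instance (S : C1System K) (i j : S.I) : Module ℂ (S.VM i j) :=
  inferInstanceAs (Module ℂ (S.vm i j))

/-- The restriction `D(F(k)/F(i)) → D(F(j)/F(i))`. -/
def fnPull (S : C1System K) {i j k : S.I} (h : i ≤ j) (h' : j ≤ k) :
    S.Fn (h.trans h') →ₗ[ℂ] S.Fn h :=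
  C1Str.pull (S.adm h h')

/-- The integration over the fibres, `D(F(k)/F(i)) ⊗ μ(F(j)/F(i)) → D(F(k)/F(j))`. -/
def fnPush (S : C1System K) {i j k : S.I} (h : i ≤ j) (h' : j ≤ k) :
    S.Fn (h.trans h') →ₗ[ℂ] S.Ms h →ₗ[ℂ] S.Fn h' :=
  (C1Str.push (S.adm h h')).flip

/-- The Fourier transform `D(F(j)/F(i)) ⊗ μ(F(j)/F(i)) → D(F⁰(i)/F⁰(j))`. -/
def fnFourier (S : C1System K) (ψ : AddChar K ℂ) (hψ : ψ ≠ 1) {i j : S.I} (h : i ≤ j) :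
    S.Fn h →ₗ[ℂ] S.Ms h →ₗ[ℂ] S.dual.Fn (S.op_le h) :=
  C1Str.fourier ψ hψ (S.E h)

/-- For `l ≤ j`, the product `μ(F(j)/F(l)) ⊗ μ(F(j) | F(o)) → μ(F(l) | F(o))`, where
`μ(F(j)/F(l)) = μ(F(l) | F(j))`; it is induced by the product of measures
`μ(F(l)/F(n)) ⊗ μ(F(j)/F(l)) → μ(F(j)/F(n))` for `n ≤ l, o`. It is an isomorphism. -/
def vmul (S : C1System K) {l j : S.I} (h : l ≤ j) (o : S.I) :
    S.Ms h →ₗ[ℂ] S.VM j o →ₗ[ℂ] S.VM l o :=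
  (LinearMap.mk₂ ℂ
    (fun (a : (S.E h).mu) (m : S.vm j o) =>
      ⟨fun n => m.1 ⟨n.1, n.2.1.trans h, n.2.2⟩ ∘ₗ (S.mprod n.2.1 h).flip a,
      fun n n' hn c x =>
        (congrArg (m.1 ⟨n'.1, n'.2.1.trans h, n'.2.2⟩)
          (S.mprod_assoc hn n.2.1 h c x a)).trans
          (m.2 ⟨n.1, n.2.1.trans h, n.2.2⟩ ⟨n'.1, n'.2.1.trans h, n'.2.2⟩ hn c
            (S.mprod n.2.1 h x a))⟩)
    (fun a a' m => Subtype.ext (funext fun n => LinearMap.ext fun x =>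
      (congrArg (m.1 ⟨n.1, n.2.1.trans h, n.2.2⟩)
        (LinearMap.map_add (S.mprod n.2.1 h x) a a')).trans
        (LinearMap.map_add (m.1 ⟨n.1, n.2.1.trans h, n.2.2⟩) _ _)))
    (fun t a m => Subtype.ext (funext fun n => LinearMap.ext fun x =>
      (congrArg (m.1 ⟨n.1, n.2.1.trans h, n.2.2⟩)
        (LinearMap.map_smul (S.mprod n.2.1 h x) t a)).trans
        (LinearMap.map_smul (m.1 ⟨n.1, n.2.1.trans h, n.2.2⟩) _ _)))
    (fun _ _ _ => rfl) (fun _ _ _ => rfl) :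
      (S.E h).mu →ₗ[ℂ] S.vm j o →ₗ[ℂ] S.vm l o)

/-- The graph of the isomorphism `μ(F(l) | F(n)) = μ(F⁰(l) | F⁰(n))` that comes from
`μ(Ě) = μ(E)^*`, where `μ ∈ μ(E)` and `μ⁻¹ ∈ μ(Ě)` are related by `μ(F(p)) μ⁻¹(F(p)^⊥) = 1`.
For `k ≤ l, n ≤ k'`, a virtual measure `m` that sends `a ∈ μ(F(l)/F(k))` to `b ∈ μ(F(n)/F(k))`
corresponds to the one that sends `c⁻¹` to `d⁻¹`, for `c ∈ μ(F(k')/F(l))`, `d ∈ μ(F(k')/F(n))`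
with `a ⊗ c = b ⊗ d` in `μ(F(k')/F(k))`. This is written here with the pairing of measures on
`E` and on `Ě`, so as to be linear in both virtual measures. -/
def vmDualGraph (S : C1System K) (l n : S.I) :
    Submodule ℂ (S.vm l n × S.dual.vm (S.op l) (S.op n)) where
  carrier := {m | ∀ (k k' : S.I) (hkl : k ≤ l) (hkn : k ≤ n) (hl : l ≤ k') (hn : n ≤ k')
    (a : (S.E hkl).mu) (c : (S.E hl).mu) (c' : (S.E hl).dual.mu) (d : (S.E hn).mu)
    (p : (S.E hl).I) (q : (S.E hn).I),
    (C1Str.mass c p * C1Str.mass c' (OrderDual.toDual p)) •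
        S.mprod hkn hn (m.1.1 ⟨k, hkl, hkn⟩ a) d =
      (C1Str.mass d q * C1Str.mass (E := (S.E hn).dual)
        (m.2.1 ⟨S.op k', S.op_le hl, S.op_le hn⟩ c') (OrderDual.toDual q)) • S.mprod hkl hl a c}
  zero_mem' := fun k k' hkl hkn hl hn a c _ d _ q => by
    have h1 : S.mprod hkn hn (0 : (S.E hkn).mu) d = 0 :=
      LinearMap.map_zero₂ (S.mprod hkn hn) d
    have h2 : C1Str.mass (E := (S.E hn).dual) 0 (OrderDual.toDual q) = 0 := rfl
    exact ((congrArg (_ • ·) h1).trans (smul_zero _)).trans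
      (((congrArg (fun z => (C1Str.mass d q * z) • S.mprod hkl hl a c) h2).trans
        ((congrArg (· • S.mprod hkl hl a c) (mul_zero _)).trans (zero_smul ℂ _))).symm)
  add_mem' := fun {m m'} hm hm' k k' hkl hkn hl hn a c c' d p q => by
    have h1 := LinearMap.map_add₂ (S.mprod hkn hn) (m.1.1 ⟨k, hkl, hkn⟩ a)
      (m'.1.1 ⟨k, hkl, hkn⟩ a) d
    have h3 := congrArg₂ (· + ·) (hm k k' hkl hkn hl hn a c c' d p q)
      (hm' k k' hkl hkn hl hn a c c' d p q)
    refine ((congrArg (_ • ·) h1).trans (smul_add _ _ _)).trans (h3.trans ?_)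
    refine (add_smul _ _ _).symm.trans (congrArg (· • S.mprod hkl hl a c) ?_)
    exact (mul_add _ _ _).symm
  smul_mem' := fun t m hm k k' hkl hkn hl hn a c c' d p q => by
    have h1 := LinearMap.map_smul₂ (S.mprod hkn hn) t (m.1.1 ⟨k, hkl, hkn⟩ a) d
    have h3 := congrArg (t • ·) (hm k k' hkl hkn hl hn a c c' d p q)
    refine ((congrArg (_ • ·) h1).trans (smul_comm _ _ _)).trans (h3.trans ?_)
    refine (smul_smul _ _ _).trans (congrArg (· • S.mprod hkl hl a c) ?_)
    exact mul_left_comm _ _ _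

/-- The isomorphism `μ(F(l) | F(n)) = μ(F⁰(l) | F⁰(n))`. -/
def vmDual (S : C1System K) (l n : S.I) :
    S.VM l n →ₗ[ℂ] S.dual.VM (S.op l) (S.op n) :=
  ofGraph (S.vmDualGraph l n)


/-! ### The space `D_{F(o)}` and the two-dimensional Fourier transform -/

/-- The pairs `(l, i)` with `l ≤ i`. -/
abbrev Pair (S : C1System K) : Type u := {p : S.I × S.I // p.1 ≤ p.2}

/-- The components `D(F(i)/F(l)) ⊗ μ(F(l) | F(o))`, for `p = (l, i)`. -/
abbrev Comp (S : C1System K) (o : S.I) (p : S.Pair) : Type u := S.Fn p.2 ⊗[ℂ] S.VM p.1.1 o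

/-- For `l ≤ j ≤ i`, the map `α^* ⊗ id` from `D(F(i)/F(l)) ⊗ μ(F(l) | F(o))` to
`D(F(j)/F(l)) ⊗ μ(F(l) | F(o))`. -/
def compPull (S : C1System K) (o : S.I) {l j i : S.I} (h : l ≤ j) (h' : j ≤ i) :
    S.Comp o ⟨(l, i), h.trans h'⟩ →ₗ[ℂ] S.Comp o ⟨(l, j), h⟩ :=
  TensorProduct.map (S.fnPull h h') LinearMap.id

/-- For `l ≤ j`, the identification `M ⊗ μ(F(l) | F(o)) = M ⊗ μ(F(j)/F(l)) ⊗ μ(F(j) | F(o))`. -/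
def splitVm (S : C1System K) (o : S.I) {l j : S.I} (h : l ≤ j) (M : Type u) [AddCommGroup M]
    [Module ℂ M] : M ⊗[ℂ] S.VM l o →ₗ[ℂ] (M ⊗[ℂ] S.Ms h) ⊗[ℂ] S.VM j o :=
  (TensorProduct.assoc ℂ M (S.Ms h) (S.VM j o)).symm.toLinearMap ∘ₗ
    LinearMap.lTensor M (linInv (TensorProduct.lift (S.vmul h o)))

/-- For `l ≤ j ≤ i`, the map `β_* ⊗ id` from `D(F(i)/F(l)) ⊗ μ(F(l) | F(o))`, which is
`D(F(i)/F(l)) ⊗ μ(F(j)/F(l)) ⊗ μ(F(j) | F(o))`, to `D(F(i)/F(j)) ⊗ μ(F(j) | F(o))`. -/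
def compPush (S : C1System K) (o : S.I) {l j i : S.I} (h : l ≤ j) (h' : j ≤ i) :
    S.Comp o ⟨(l, i), h.trans h'⟩ →ₗ[ℂ] S.Comp o ⟨(j, i), h'⟩ :=
  TensorProduct.map (TensorProduct.lift (S.fnPush h h')) LinearMap.id ∘ₗ
    S.splitVm o h (S.Fn (h.trans h'))

/-- The space `D_{F(o)} = lim_← D(F(i)/F(l)) ⊗ μ(F(l) | F(o))`, as the space of all compatible
families. -/
def limD (S : C1System K) (o : S.I) : Submodule ℂ (∀ p, S.Comp o p) where
  carrier := {f | ∀ (l j i : S.I) (h : l ≤ j) (h' : j ≤ i),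
    S.compPull o h h' (f ⟨(l, i), h.trans h'⟩) = f ⟨(l, j), h⟩ ∧
    S.compPush o h h' (f ⟨(l, i), h.trans h'⟩) = f ⟨(j, i), h'⟩}
  zero_mem' := fun _ _ _ h h' =>
    ⟨LinearMap.map_zero (S.compPull o h h'), LinearMap.map_zero (S.compPush o h h')⟩
  add_mem' := fun {_ _} hf hg l j i h h' =>
    ⟨(LinearMap.map_add (S.compPull o h h') _ _).trans
        (congrArg₂ (· + ·) (hf l j i h h').1 (hg l j i h h').1),
      (LinearMap.map_add (S.compPush o h h') _ _).trans
        (congrArg₂ (· + ·) (hf l j i h h').2 (hg l j i h h').2)⟩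
  smul_mem' := fun c _ hf l j i h h' =>
    ⟨(LinearMap.map_smul (S.compPull o h h') c _).trans (congrArg (c • ·) (hf l j i h h').1),
      (LinearMap.map_smul (S.compPush o h h') c _).trans (congrArg (c • ·) (hf l j i h h').2)⟩

/-- For `j ≤ i`, the map `F ⊗ id` from `D(F(i)/F(j)) ⊗ μ(F(j) | F(o))`, which is
`D(F(i)/F(j)) ⊗ μ(F(i)/F(j)) ⊗ μ(F(i) | F(o))`, to
`D(F⁰(j)/F⁰(i)) ⊗ μ(F⁰(i) | F⁰(o))`. -/
def compFourier (S : C1System K) (ψ : AddChar K ℂ) (hψ : ψ ≠ 1) (o : S.I) {j i : S.I}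
    (h : j ≤ i) : S.Comp o ⟨(j, i), h⟩ →ₗ[ℂ]
      S.dual.Comp (S.op o) ⟨(S.op i, S.op j), S.op_le h⟩ :=
  TensorProduct.map (TensorProduct.lift (S.fnFourier ψ hψ h)) (S.vmDual i o) ∘ₗ
    S.splitVm o h (S.Fn h)

/-- The two-dimensional Fourier transform, which is `F ⊗ id` on each component. -/
def fourier (S : C1System K) (ψ : AddChar K ℂ) (hψ : ψ ≠ 1) (o : S.I) :
    (∀ p, S.Comp o p) →ₗ[ℂ] ∀ p, S.dual.Comp (S.op o) p :=
  LinearMap.pi fun p => S.compFourier ψ hψ o p.2 ∘ₗ LinearMap.proj (⟨(p.1.2, p.1.1), p.2⟩ : S.Pair)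

/-! ### Systems of compact and of discrete `C₁`-spaces -/

def IsCf (S : C1System K) : Prop := ∀ {i j : S.I} (h : i ≤ j), (S.E h).IsCompact

def IsDf (S : C1System K) : Prop := ∀ {i j : S.I} (h : i ≤ j), (S.E h).IsDiscrete

theorem IsCf.dual {S : C1System K} (h : S.IsCf) : S.dual.IsDf := fun h' =>
  (h (OrderDual.ofDual_le_ofDual.2 h')).dual

theorem IsDf.dual {S : C1System K} (h : S.IsDf) : S.dual.IsCf := fun h' =>
  (h (OrderDual.ofDual_le_ofDual.2 h')).dual

/-- The canonical element `1_{kl} ∈ μ(F(k) | F(l))` when all the `F(j)/F(i)` are compact: it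
comes from the measures of total mass `1` on the spaces `F(j)/F(i)`, and so is the (unique)
virtual measure that preserves the total mass of measures. -/
def vmOne (S : C1System K) (hS : S.IsCf) (k l : S.I) : S.VM k l :=
  Classical.epsilon fun m : S.vm k l => ∀ n x, (m.1 n x).1 (C1Str.one _ (hS n.2.2)) =
    x.1 (C1Str.one _ (hS n.2.1))

/-- The canonical element `δ_{kl} ∈ μ(F(k) | F(l))` when all the `F(j)/F(i)` are discrete: it
comes from the measures on the spaces `F(j)/F(i)` for which `{0}` has mass `1`, and so is the
(unique) virtual measure that preserves the mass of `{0}`. -/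
def vmDelta (S : C1System K) (hS : S.IsDf) (k l : S.I) : S.VM k l :=
  Classical.epsilon fun m : S.vm k l => ∀ n x, (m.1 n x).1 (C1Str.deltaZero _ (hS n.2.2)) =
    x.1 (C1Str.deltaZero _ (hS n.2.1))

/-- The function `1 ∈ D(F(j)/F(i))`. -/
def fnOne (S : C1System K) (hS : S.IsCf) {i j : S.I} (h : i ≤ j) : S.Fn h :=
  C1Str.one (S.E h) (hS h)

/-- The element `1`, with components `1 ⊗ 1_{lo} ∈ D(F(i)/F(l)) ⊗ μ(F(l) | F(o))`. -/
def oneElt (S : C1System K) (hS : S.IsCf) (o : S.I) : ∀ p, S.Comp o p :=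
  fun p => S.fnOne hS p.2 ⊗ₜ[ℂ] S.vmOne hS p.1.1 o

end C1System

/-! ## Admissible triples of systems of `C₁`-spaces -/

/-- The system of admissible triples of `C₁`-spaces
`0 → F₁(ε(j))/F₁(ε(i)) → F₂(j)/F₂(i) → F₃(γ(j))/F₃(γ(i)) → 0`, for `i ≤ j`, attached to an
admissible triple of `C₂`-spaces. -/
structure C1SysTriple (K : Type u) [Field K] where
  S₁ : C1System K
  S₂ : C1System K
  S₃ : C1System K
  ε : S₂.I →o S₁.I
  γ : S₂.I →o S₃.I
  a : ∀ {i j : S₂.I} (h : i ≤ j), S₁.Q (ε.monotone h) →ₗ[K] S₂.Q h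
  b : ∀ {i j : S₂.I} (h : i ≤ j), S₂.Q h →ₗ[K] S₃.Q (γ.monotone h)
  adm : ∀ {i j : S₂.I} (h : i ≤ j), (S₁.E (ε.monotone h)).IsAdmissible (S₂.E h)
    (S₃.E (γ.monotone h)) (a h) (b h)
  a_ι : ∀ {i j k : S₂.I} (h : i ≤ j) (h' : j ≤ k) (x : S₁.Q (ε.monotone h)),
    a (h.trans h') (S₁.ι (ε.monotone h) (ε.monotone h') x) = S₂.ι h h' (a h x)
  a_ρ : ∀ {i j k : S₂.I} (h : i ≤ j) (h' : j ≤ k) (x : S₁.Q (ε.monotone (h.trans h'))),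
    a h' (S₁.ρ (ε.monotone h) (ε.monotone h') x) = S₂.ρ h h' (a (h.trans h') x)
  b_ι : ∀ {i j k : S₂.I} (h : i ≤ j) (h' : j ≤ k) (x : S₂.Q h),
    b (h.trans h') (S₂.ι h h' x) = S₃.ι (γ.monotone h) (γ.monotone h') (b h x)
  b_ρ : ∀ {i j k : S₂.I} (h : i ≤ j) (h' : j ≤ k) (x : S₂.Q (h.trans h')),
    b h' (S₂.ρ h h' x) = S₃.ρ (γ.monotone h) (γ.monotone h') (b (h.trans h') x)

namespace C1SysTriple

variable {K : Type u} [Field K]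

/-- The dual triple `0 → Ě₃ → Ě₂ → Ě₁ → 0`. -/
def dual (T : C1SysTriple K) : C1SysTriple K where
  S₁ := T.S₃.dual
  S₂ := T.S₂.dual
  S₃ := T.S₁.dual
  ε := T.γ.dual
  γ := T.ε.dual
  a h := C1Str.dualMap (T.adm (OrderDual.ofDual_le_ofDual.2 h)).isMor_right
  b h := C1Str.dualMap (T.adm (OrderDual.ofDual_le_ofDual.2 h)).isMor_left
  adm h := (T.adm (OrderDual.ofDual_le_ofDual.2 h)).dual
  a_ι h h' w :=
    Subtype.ext (LinearMap.ext fun x => congrArg w.1 (T.b_ρ (OrderDual.ofDual_le_ofDual.2 h')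
      (OrderDual.ofDual_le_ofDual.2 h) x).symm)
  a_ρ h h' w :=
    Subtype.ext (LinearMap.ext fun x => congrArg w.1 (T.b_ι (OrderDual.ofDual_le_ofDual.2 h')
      (OrderDual.ofDual_le_ofDual.2 h) x).symm)
  b_ι h h' w :=
    Subtype.ext (LinearMap.ext fun x => congrArg w.1 (T.a_ρ (OrderDual.ofDual_le_ofDual.2 h')
      (OrderDual.ofDual_le_ofDual.2 h) x).symm)
  b_ρ h h' w :=
    Subtype.ext (LinearMap.ext fun x => congrArg w.1 (T.a_ι (OrderDual.ofDual_le_ofDual.2 h')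
      (OrderDual.ofDual_le_ofDual.2 h) x).symm)

/-- The graph of the map `μ(F₁(ε(i)) | F₁(ε(j))) → μ(F₂(i) | F₂(j))`, `m₁ ↦ m₁ ⊗ m₃`, where
`m₃ ∈ μ(F₃(γ(i)) | F₃(γ(j)))`. -/
def vmProdGraph (T : C1SysTriple K) (i j : T.S₂.I) (m₃ : T.S₃.vm (T.γ i) (T.γ j)) :
    Submodule ℂ (T.S₁.vm (T.ε i) (T.ε j) × T.S₂.vm i j) where
  carrier := {m | ∀ (n : T.S₂.I) (hi : n ≤ i) (hj : n ≤ j)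
    (x : (T.S₁.E (T.ε.monotone hi)).mu) (y : (T.S₃.E (T.γ.monotone hi)).mu),
    m.2.1 ⟨n, hi, hj⟩ (C1Str.prod (T.adm hi) x y) =
      C1Str.prod (T.adm hj) (m.1.1 ⟨T.ε n, T.ε.monotone hi, T.ε.monotone hj⟩ x)
        (m₃.1 ⟨T.γ n, T.γ.monotone hi, T.γ.monotone hj⟩ y)}
  zero_mem' := fun n hi hj _ y => (LinearMap.map_zero₂ (C1Str.prod (T.adm hj))
    (m₃.1 ⟨T.γ n, T.γ.monotone hi, T.γ.monotone hj⟩ y)).symm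
  add_mem' := fun hm hm' n hi hj x y =>
    (congrArg₂ (· + ·) (hm n hi hj x y) (hm' n hi hj x y)).trans
      (LinearMap.map_add₂ (C1Str.prod (T.adm hj)) _ _
        (m₃.1 ⟨T.γ n, T.γ.monotone hi, T.γ.monotone hj⟩ y)).symm
  smul_mem' := fun c _ hm n hi hj x y =>
    (congrArg (c • ·) (hm n hi hj x y)).trans
      (LinearMap.map_smul₂ (C1Str.prod (T.adm hj)) c _
        (m₃.1 ⟨T.γ n, T.γ.monotone hi, T.γ.monotone hj⟩ y)).symm

/-- The map `m₁ ↦ m₁ ⊗ m₃` that comes from the canonical isomorphism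
`μ(F₁(ε(i)) | F₁(ε(j))) ⊗ μ(F₃(γ(i)) | F₃(γ(j))) = μ(F₂(i) | F₂(j))`. -/
def vmProd (T : C1SysTriple K) (i j : T.S₂.I) (m₃ : T.S₃.VM (T.γ i) (T.γ j)) :
    T.S₁.VM (T.ε i) (T.ε j) →ₗ[ℂ] T.S₂.VM i j :=
  ofGraph (T.vmProdGraph i j m₃)

/-- The direct image (extension by zero)
`D(F₁(ε(j))/F₁(ε(i))) → D(F₂(j)/F₂(i))` when `E₃` is a `dfC₂`-space. -/
def fnExtend (T : C1SysTriple K) (h₃ : T.S₃.IsDf) {i j : T.S₂.I} (h : i ≤ j) :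
    T.S₁.Fn (T.ε.monotone h) →ₗ[ℂ] T.S₂.Fn h :=
  C1Str.extendZero (T.adm h) (h₃ (T.γ.monotone h))

/-- The direct image `α_*` from `D_{F₁(ε(o))}(E₁)` to `D_{F₂(o)}(E₂)` when `E₃` is a
`dfC₂`-space: extension by zero, tensored with the identification
`μ(F₁(ε(l)) | F₁(ε(o))) = μ(F₂(l) | F₂(o))` given by the canonical elements
`δ ∈ μ(F₃(γ(l)) | F₃(γ(o)))`. -/
def alphaPush (T : C1SysTriple K) (h₃ : T.S₃.IsDf) (o : T.S₂.I)
    (f : ∀ p, T.S₁.Comp (T.ε o) p) : ∀ p, T.S₂.Comp o p :=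
  fun p => TensorProduct.map (T.fnExtend h₃ p.2)
    (T.vmProd p.1.1 o (T.S₃.vmDelta h₃ (T.γ p.1.1) (T.γ o)))
    (f ⟨(T.ε p.1.1, T.ε p.1.2), T.ε.monotone p.2⟩)

/-- `δ_{E₁} = α_*(1)`. -/
def delta (T : C1SysTriple K) (h₁ : T.S₁.IsCf) (h₃ : T.S₃.IsDf) (o : T.S₂.I) :
    ∀ p, T.S₂.Comp o p :=
  T.alphaPush h₃ o (T.S₁.oneElt h₁ (T.ε o))

end C1SysTriple

/-! ## `C₂`-spaces -/

/-- A `C₂`-space `(I, F, V)` over `K`. -/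
structure C2Space (K : Type u) [Field K] where
  V : Type u
  [acg : AddCommGroup V]
  [mod : Module K V]
  fil : Filtration K V
  E : ∀ {i j : fil.I}, i ≤ j → C1Str K (SubQ (fil.F i) (fil.F j))
  adm : ∀ {i j k : fil.I} (h : i ≤ j) (h' : j ≤ k),
    (E h).IsAdmissible (E (h.trans h')) (E h')
      (subQMap LinearMap.id le_rfl (fil.mono h'))
      (subQMap LinearMap.id (fil.mono h) le_rfl)

attribute [instance] C2Space.acg C2Space.mod

namespace C2Space

variable {K : Type u} [Field K]

/-- The `C₂`-space is complete: all the `C₁`-spaces `F(j)/F(i)` are complete, and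
`V = lim_{→ i} lim_{← j ≤ i} F(i)/F(j)`. -/
def IsComplete (E : C2Space K) : Prop :=
  (∀ {i j : E.fil.I} (h : i ≤ j), (E.E h).toFiltration.IsComplete) ∧ E.fil.IsComplete

/-- The system of the `C₁`-spaces `F(j)/F(i)`. -/
def sys (E : C2Space K) : C1System K where
  I := E.fil.I
  Q {i j} _ := SubQ (E.fil.F i) (E.fil.F j)
  E h := E.E h
  ι _ h' := subQMap LinearMap.id le_rfl (E.fil.mono h')
  ρ h _ := subQMap LinearMap.id (E.fil.mono h) le_rfl
  adm h h' := E.adm h h'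
  ι_ι _ _ _ x := by
    obtain ⟨x, rfl⟩ := Submodule.Quotient.mk_surjective _ x
    rfl
  ρ_ρ _ _ _ x := by
    obtain ⟨x, rfl⟩ := Submodule.Quotient.mk_surjective _ x
    rfl
  ρ_ι _ _ _ x := by
    obtain ⟨x, rfl⟩ := Submodule.Quotient.mk_surjective _ x
    rfl

/-- `E` is a `cfC₂`-space: all the `C₁`-spaces `F(j)/F(i)` are compact. -/
def IsCf (E : C2Space K) : Prop := E.sys.IsCf

/-- `E` is a `dfC₂`-space: all the `C₁`-spaces `F(j)/F(i)` are discrete. -/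
def IsDf (E : C2Space K) : Prop := E.sys.IsDf

/-- `0 → E₁ → E₂ → E₃ → 0` is an admissible triple of `C₂`-spaces, with order-preserving
functions `ε` and `γ` such that `F₂(i) ∩ V₁ = F₁(ε(i))` and `β(F₂(i)) = F₃(γ(i))`. -/
structure IsAdmissible (E₁ E₂ E₃ : C2Space K) (α : E₁.V →ₗ[K] E₂.V) (β : E₂.V →ₗ[K] E₃.V)
    (ε : E₂.fil.I →o E₁.fil.I) (γ : E₂.fil.I →o E₃.fil.I) : Prop where
  inj : Function.Injective α
  exact : Function.Exact α β
  surj : Function.Surjective β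
  dom₁ : E₁.fil.DominatesVia (fun i => (E₂.fil.F i).comap α) ε
  dom₃ : E₃.fil.DominatesVia (fun i => (E₂.fil.F i).map β) γ
  adm : ∀ {i j : E₂.fil.I} (h : i ≤ j),
    (E₁.E (ε.monotone h)).IsAdmissible (E₂.E h) (E₃.E (γ.monotone h))
      (subQMap α (dom₁.1 i).le (dom₁.1 j).le)
      (subQMap β (Submodule.map_le_iff_le_comap.1 (dom₃.1 i).ge)
        (Submodule.map_le_iff_le_comap.1 (dom₃.1 j).ge))

/-- The admissible triples of the `C₁`-spaces of an admissible triple of `C₂`-spaces. -/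
def IsAdmissible.triple {E₁ E₂ E₃ : C2Space K} {α : E₁.V →ₗ[K] E₂.V} {β : E₂.V →ₗ[K] E₃.V}
    {ε : E₂.fil.I →o E₁.fil.I} {γ : E₂.fil.I →o E₃.fil.I}
    (h : IsAdmissible E₁ E₂ E₃ α β ε γ) : C1SysTriple K where
  S₁ := E₁.sys
  S₂ := E₂.sys
  S₃ := E₃.sys
  ε := ε
  γ := γ
  a {i j} _ := subQMap α (h.dom₁.1 i).le (h.dom₁.1 j).le
  b {i j} _ := subQMap β (Submodule.map_le_iff_le_comap.1 (h.dom₃.1 i).ge)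
    (Submodule.map_le_iff_le_comap.1 (h.dom₃.1 j).ge)
  adm := h.adm
  a_ι _ _ x := by
    obtain ⟨x, rfl⟩ := Submodule.Quotient.mk_surjective _ x
    rfl
  a_ρ _ _ x := by
    obtain ⟨x, rfl⟩ := Submodule.Quotient.mk_surjective _ x
    rfl
  b_ι _ _ x := by
    obtain ⟨x, rfl⟩ := Submodule.Quotient.mk_surjective _ x
    rfl
  b_ρ _ _ x := by
    obtain ⟨x, rfl⟩ := Submodule.Quotient.mk_surjective _ x
    rfl

end C2Space

end

/-! At each level `(j, i)`, `δ_{E₁}` is the characteristic function of the subspace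
`F₁(ε(i))/F₁(ε(j))` of `F₂(i)/F₂(j)`, tensored with a virtual measure. The formula thus combines two
facts: the Fourier transform of the characteristic function of a subspace is a multiple of that of
its annihilator, and all the scalars that occur are equal to `1`.

The scalars are controlled by a `UnitFamily`: functions `e` on all the `F(j)/F(i)` that restrict to
one another, whose fibre integrals against `c` are `c(e) • e`, and on which some measure has the
value `1`. Since spaces of invariant measures are lines (`C1Str.exists_eq_smul`), `m ↦ m(e)` is a
coordinate on each of them, and by `val_mprod` these coordinates are multiplicative. Hence there is
exactly one virtual measure `virt` that preserves values, it spans its line, and the components `e ⊗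
virt` form an element `elt` of `limD` (`elt_mem_limD`). The functions `1`, the functions `δ₀` and
the characteristic functions of the subspaces `V₁` are such families; `delta_eq` identifies `δ_{E₁}`
with the element `elt` of the third one.

For the Fourier transform, `fourier_charRange` gives `m(V₁)` times the characteristic function of
`V₁^⊥`, and this factor is `1` for the unit measure. The virtual measure goes to the one of the dual
triple because `c ↦ c(V₁)` and `c' ↦ c'(V₁^⊥)` are inverse to each other under the pairing of `μ(E)`
and `μ(Ě)` (`integral_charRange_mul_dual`, `vmDual_virt`). That last fact reduces by
multiplicativity to the compact and the discrete case, where it says that the pairing `mass c p *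
mass c' p` does not depend on `p`. -/

/-! ### Coset sums and invariant measures on `C₁`-spaces. -/

/-- The fibres of `π` are cosets of the kernel, so a set-theoretic section identifies `A` with `B ×
ker π`. It serves to compare coset sums at two levels of a filtration. -/
theorem finsum_comp_of_finite_ker {A B : Type*} [AddCommGroup A] [AddCommGroup B]
    (π : A →+ B) (hπ : Function.Surjective π) [Finite π.ker] (g : B → ℂ)
    (hg : (Function.support g).Finite) :
    ∑ᶠ a, g (π a) = Nat.card π.ker * ∑ᶠ b, g b := by
  let s := Function.surjInv hπ
  have hs : ∀ b, π (s b) = b := Function.surjInv_eq hπ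
  let e : B × π.ker ≃ A :=
    { toFun := fun x => s x.1 + x.2.1
      invFun := fun a => (π a, ⟨a - s (π a), by
        rw [AddMonoidHom.mem_ker, map_sub, hs, sub_self]⟩)
      left_inv := fun x => by
        have h1 : π (s x.1 + x.2.1) = x.1 := by
          rw [map_add, hs, AddMonoidHom.mem_ker.1 x.2.2, add_zero]
        refine Prod.ext h1 (Subtype.ext ?_)
        change s x.1 + x.2.1 - s (π (s x.1 + x.2.1)) = x.2.1
        rw [h1, add_sub_cancel_left]
      right_inv := fun a => add_sub_cancel _ _ }
  have h1 : ∀ x : B × π.ker, g (π (e x)) = g x.1 := fun x => by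
    change g (π (s x.1 + x.2.1)) = _
    rw [map_add, hs, AddMonoidHom.mem_ker.1 x.2.2, add_zero]
  rw [← finsum_comp_equiv e, finsum_congr h1, finsum_curry, mul_finsum]
  · refine finsum_congr fun b => ?_
    have := Fintype.ofFinite π.ker
    change ∑ᶠ _ : π.ker, g b = _
    rw [finsum_eq_sum_of_fintype, Finset.sum_const, Finset.card_univ, nsmul_eq_mul,
      Nat.card_eq_fintype_card]
  · refine (hg.prod (Set.finite_univ (α := π.ker))).subset fun x hx => ⟨hx, trivial⟩

theorem SubQ.natCard_eq {K V W : Type u} [Field K] [AddCommGroup V] [Module K V]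
    [AddCommGroup W] [Module K W] {A B : Submodule K V} (G : B →ₗ[K] W)
    (h : ∀ x, G x = 0 ↔ x.1 ∈ A) (hG : Function.Surjective G) :
    Nat.card (SubQ A B) = Nat.card W := by
  have hker : A.submoduleOf B = LinearMap.ker G := by
    ext x
    exact (h x).symm
  exact Nat.card_congr
    ((Submodule.quotEquivOfEq _ _ hker).trans (G.quotKerEquivOfSurjective hG)).toEquiv

namespace C1Str

variable {K V : Type u} [Field K] [AddCommGroup V] [Module K V]

/-- The sum of the values of `f` at representatives of the cosets of `F(i)`. -/
noncomputable def cosetSum (E : C1Str K V) (i : E.I) (f : V → ℂ) : ℂ :=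
  ∑ᶠ q : V ⧸ E.F i, f q.out

/-- This makes `cosetSum` independent of the representatives `q.out` for invariant functions. -/
theorem apply_out (E : C1Str K V) {i : E.I} {f : V → ℂ} (hf : ∀ w ∈ E.F i, ∀ v, f (v + w) = f v)
    (v : V) : f (Quotient.out (Submodule.Quotient.mk v : V ⧸ E.F i)) = f v := by
  set y := Quotient.out (Submodule.Quotient.mk v : V ⧸ E.F i) with hy
  have h1 : (Submodule.Quotient.mk y : V ⧸ E.F i) = Submodule.Quotient.mk v := Quotient.out_eq _
  have h2 := hf (y - v) ((Submodule.Quotient.eq _).1 h1) v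
  rwa [add_sub_cancel] at h2

theorem apply_out' (E : C1Str K V) {i : E.I} {f : V → ℂ}
    (hf : ∀ w ∈ E.F i, ∀ v, f (v + w) = f v) {v : V} {q : V ⧸ E.F i}
    (h : Submodule.Quotient.mk v = q) : f q.out = f v := by
  rw [← h, E.apply_out hf]

theorem cosetSum_smul (E : C1Str K V) (i : E.I) (c : ℂ) (f : V → ℂ) :
    E.cosetSum i (c • f) = c * E.cosetSum i f := by
  unfold cosetSum
  rw [← smul_eq_mul, smul_finsum]
  rfl

theorem cosetSum_translate (E : C1Str K V) (i : E.I) (a : V) (f : V → ℂ)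
    (hf : ∀ w ∈ E.F i, ∀ v, f (v + w) = f v) :
    E.cosetSum i (fun v => f (v + a)) = E.cosetSum i f := by
  unfold cosetSum
  rw [← finsum_comp_equiv (f := fun q : V ⧸ E.F i => f q.out)
    (Equiv.addRight (Submodule.Quotient.mk a : V ⧸ E.F i))]
  refine finsum_congr fun q => (E.apply_out' hf ?_).symm
  rw [Submodule.Quotient.mk_add]
  exact congrArg (· + Submodule.Quotient.mk a) (Quotient.out_eq q)

theorem charFun_add (E : C1Str K V) (i : E.I) : ∀ w ∈ E.F i, ∀ v,
    (E.charFun i).1 (v + w) = (E.charFun i).1 v := fun w hw v => by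
  classical
  change Set.indicator (E.F i : Set V) 1 (v + w) = Set.indicator (E.F i : Set V) 1 v
  simp only [Set.indicator_apply, SetLike.mem_coe, (E.F i).add_mem_iff_left hw,
    Pi.one_apply]

theorem exists_invariance_index (E : C1Str K V) (p : E.I) (f : E.D) :
    ∃ i, i ≤ p ∧ ∀ w ∈ E.F i, ∀ v, f.1 (v + w) = f.1 v := by
  obtain ⟨i, _, _, _, hf⟩ := f.2
  obtain ⟨k, hki, hkp⟩ := E.exists_le i p
  exact ⟨k, hkp, fun w hw => hf w (E.mono hki hw)⟩

/-- Restriction of functionals to `F(q)` identifies `F(p)^⊥/F(q)^⊥` with the dual of the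
finite-dimensional space `F(q)/F(p)`, which has the same dimension. -/
theorem card_dual_subQ (E : C1Str K V) {p q : E.I} (h : p ≤ q) :
    Nat.card (SubQ (V := E.dualSpace) (E.dual.F (OrderDual.toDual q))
      (E.dual.F (OrderDual.toDual p))) =
      Nat.card (SubQ (E.F p) (E.F q)) := by
  have := E.finite_quot p q h
  let G : ↥(E.dual.F (OrderDual.toDual p)) →ₗ[K] Module.Dual K (SubQ (E.F p) (E.F q)) :=
    { toFun := fun w => Submodule.liftQ _ ((w.1.1 : V →ₗ[K] K).comp (E.F q).subtype)
        (fun x hx => (E.mem_dual_F p w.1).1 w.2 x.1 hx)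
      map_add' := fun w w' => by
        apply Submodule.linearMap_qext
        ext x
        rfl
      map_smul' := fun c w => by
        apply Submodule.linearMap_qext
        ext x
        rfl }
  have hker : ∀ w, G w = 0 ↔ w.1 ∈ E.dual.F (OrderDual.toDual q) := by
    intro w
    constructor
    · intro hw
      exact (E.mem_dual_F q w.1).2 fun x hx =>
        LinearMap.congr_fun hw (Submodule.Quotient.mk ⟨x, hx⟩)
    · intro hw
      apply Submodule.linearMap_qext
      ext x
      exact (E.mem_dual_F q w.1).1 hw x.1 x.2
  have hsurj : Function.Surjective G := by
    intro u
    let θ : SubQ (E.F p) (E.F q) →ₗ[K] V ⧸ E.F p :=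
      Submodule.mapQ ((E.F p).submoduleOf (E.F q)) (E.F p) (E.F q).subtype fun _ hx => hx
    have hθ : LinearMap.ker θ = ⊥ := by
      rw [LinearMap.ker_eq_bot']
      intro x hx
      obtain ⟨x, rfl⟩ := Submodule.Quotient.mk_surjective _ x
      exact (Submodule.Quotient.mk_eq_zero _).2 ((Submodule.Quotient.mk_eq_zero (E.F p)).1 hx)
    -- A retraction of `V/F(p)` onto `F(q)/F(p)` extends `u` to a functional on `V` that kills
    -- `F(p)`, hence lies in `V̌`.
    obtain ⟨ρ, hρ⟩ := θ.exists_leftInverse_of_injective hθ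
    have hw : (u.comp ρ).comp (E.F p).mkQ ∈ (E.F p).dualAnnihilator := by
      rw [Submodule.mem_dualAnnihilator]
      intro x hx
      have : (E.F p).mkQ x = 0 := by simpa using hx
      simp [this]
    refine ⟨⟨⟨(u.comp ρ).comp (E.F p).mkQ, p, hw⟩, hw⟩, ?_⟩
    apply Submodule.linearMap_qext
    ext x
    exact congrArg u (LinearMap.congr_fun hρ (Submodule.Quotient.mk x))
  rw [SubQ.natCard_eq G hker hsurj, Module.natCard_eq_pow_finrank (K := K),
    Module.natCard_eq_pow_finrank (K := K) (V := SubQ (E.F p) (E.F q)), Subspace.dual_finrank_eq]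

variable [Finite K]

theorem finite_subQ (E : C1Str K V) {i j : E.I} (h : i ≤ j) : Finite (SubQ (E.F i) (E.F j)) := by
  have := E.finite_quot i j h
  exact Module.finite_of_finite K

/-- Only cosets with representative in `F(j)` contribute, and they come from `F(j)/F(i)`, which is
finite because `K` is. -/
theorem finite_coset_support (E : C1Str K V) {i j : E.I} (h : i ≤ j) {f : V → ℂ}
    (hf : ∀ v, v ∉ E.F j → f v = 0) :
    (Function.support fun q : V ⧸ E.F i => f q.out).Finite := by
  have := E.finite_subQ h
  refine (Set.finite_range (Submodule.mapQ ((E.F i).submoduleOf (E.F j)) (E.F i)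
    (E.F j).subtype fun _ hx => hx)).subset fun q hq => ?_
  have h1 : q.out ∈ E.F j := by
    by_contra hcon
    exact hq (hf _ hcon)
  exact ⟨Submodule.Quotient.mk ⟨q.out, h1⟩, Quotient.out_eq q⟩

/-- `N` is the index of `F(k)` in `F(i)`. It is chosen before `f`, so that the same factor serves
for `f` and for `δ_{F(p)}` and cancels in their quotient. -/
theorem cosetSum_of_le (E : C1Str K V) {k i : E.I} (h : k ≤ i) :
    ∃ N : ℂ, N ≠ 0 ∧ ∀ f ∈ E.D, (∀ w ∈ E.F i, ∀ v, f (v + w) = f v) →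
      E.cosetSum k f = N * E.cosetSum i f := by
  let π : (V ⧸ E.F k) →ₗ[K] V ⧸ E.F i := Submodule.factor (E.mono h)
  have hfin : Finite π.toAddMonoidHom.ker := by
    have := E.finite_subQ h
    refine ((Set.finite_range (Submodule.mapQ ((E.F k).submoduleOf (E.F i)) (E.F k)
      (E.F i).subtype fun _ hx => hx)).subset fun q hq => ?_ :
        (π.toAddMonoidHom.ker : Set (V ⧸ E.F k)).Finite)
    obtain ⟨v, rfl⟩ := Submodule.Quotient.mk_surjective _ q
    exact ⟨Submodule.Quotient.mk ⟨v, (Submodule.Quotient.mk_eq_zero _).1 hq⟩, rfl⟩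
  refine ⟨Nat.card π.toAddMonoidHom.ker, ?_, ?_⟩
  · exact_mod_cast Nat.card_pos.ne'
  · rintro f ⟨_, j, _, hf, _⟩ hi
    obtain ⟨j', hij', hjj'⟩ := E.exists_ge i j
    refine Eq.trans ?_ (finsum_comp_of_finite_ker π.toAddMonoidHom
      (Submodule.factor_surjective (E.mono h)) (fun q => f q.out)
      (E.finite_coset_support hij' fun v hv => hf v fun hv' => hv (E.mono hjj' hv')))
    refine finsum_congr fun q => (E.apply_out' hi ?_).symm
    change _ = π q
    conv_rhs => rw [← Quotient.out_eq q]
    rfl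

theorem cosetSum_add (E : C1Str K V) (i : E.I) {f g : V → ℂ} (hf : f ∈ E.D) (hg : g ∈ E.D) :
    E.cosetSum i (f + g) = E.cosetSum i f + E.cosetSum i g := by
  obtain ⟨_, j, _, hf, _⟩ := hf
  obtain ⟨_, k, _, hg, _⟩ := hg
  obtain ⟨j', hij', hjj'⟩ := E.exists_ge i j
  obtain ⟨k', hik', hkk'⟩ := E.exists_ge i k
  exact finsum_add_distrib
    (E.finite_coset_support hij' fun v hv => hf v fun hv' => hv (E.mono hjj' hv'))
    (E.finite_coset_support hik' fun v hv => hg v fun hv' => hv (E.mono hkk' hv'))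

theorem cosetSum_charFun (E : C1Str K V) {i p : E.I} (h : i ≤ p) :
    E.cosetSum i (E.charFun p).1 = Nat.card (SubQ (E.F i) (E.F p)) := by
  have := E.finite_subQ h
  let θ : SubQ (E.F i) (E.F p) →ₗ[K] V ⧸ E.F i :=
    Submodule.mapQ ((E.F i).submoduleOf (E.F p)) (E.F i) (E.F p).subtype fun _ hx => hx
  have hθ : Function.Injective θ := by
    rw [← LinearMap.ker_eq_bot, LinearMap.ker_eq_bot']
    intro x hx
    obtain ⟨x, rfl⟩ := Submodule.Quotient.mk_surjective _ x
    exact (Submodule.Quotient.mk_eq_zero _).2 ((Submodule.Quotient.mk_eq_zero (E.F i)).1 hx)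
  have h1 : ∀ q : V ⧸ E.F i, (E.charFun p).1 q.out = Set.indicator (Set.range θ) 1 q := by
    intro q
    obtain ⟨v, rfl⟩ := Submodule.Quotient.mk_surjective _ q
    rw [E.apply_out (fun w hw => E.charFun_add p w (E.mono h hw))]
    by_cases hv : v ∈ E.F p
    · trans (1 : ℂ)
      · exact Set.indicator_of_mem hv _
      · exact (Set.indicator_of_mem (s := Set.range θ)
          ⟨Submodule.Quotient.mk ⟨v, hv⟩, rfl⟩ (1 : V ⧸ E.F i → ℂ)).symm
    · rw [Set.indicator_of_notMem]
      · exact Set.indicator_of_notMem hv _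
      · rintro ⟨x, hx⟩
        obtain ⟨x, rfl⟩ := Submodule.Quotient.mk_surjective _ x
        have h2 := E.mono h ((Submodule.Quotient.eq (E.F i)).1 hx)
        have h3 := (E.F p).sub_mem x.2 h2
        rw [Submodule.subtype_apply, sub_sub_cancel] at h3
        exact hv h3
  unfold cosetSum
  rw [finsum_congr h1, ← finsum_mem_def, finsum_mem_range hθ]
  have := Fintype.ofFinite (SubQ (E.F i) (E.F p))
  rw [finsum_eq_sum_of_fintype]
  simp [Nat.card_eq_fintype_card]

theorem cosetSum_charFun_ne_zero (E : C1Str K V) {i p : E.I} (h : i ≤ p) :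
    E.cosetSum i (E.charFun p).1 ≠ 0 := by
  have := E.finite_subQ h
  rw [E.cosetSum_charFun h]
  exact_mod_cast Nat.card_pos.ne'

/-- This is what makes `haar` well defined: passing to a common lower bound multiplies numerator and
denominator by the same index. -/
theorem cosetSum_div_eq (E : C1Str K V) {p i k : E.I} (hi : i ≤ p) (hk : k ≤ p) {f : V → ℂ}
    (hf : f ∈ E.D) (hfi : ∀ w ∈ E.F i, ∀ v, f (v + w) = f v)
    (hfk : ∀ w ∈ E.F k, ∀ v, f (v + w) = f v) :
    E.cosetSum i f / E.cosetSum i (E.charFun p).1 =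
      E.cosetSum k f / E.cosetSum k (E.charFun p).1 := by
  obtain ⟨l, hli, hlk⟩ := E.exists_le i k
  obtain ⟨N, hN, hN'⟩ := E.cosetSum_of_le hli
  obtain ⟨M, hM, hM'⟩ := E.cosetSum_of_le hlk
  have hp : ∀ {n} (_ : n ≤ p), ∀ w ∈ E.F n, ∀ v, (E.charFun p).1 (v + w) = (E.charFun p).1 v :=
    fun hn w hw => E.charFun_add p w (E.mono hn hw)
  trans E.cosetSum l f / E.cosetSum l (E.charFun p).1
  · rw [hN' f hf hfi, hN' _ (E.charFun p).2 (hp hi), mul_div_mul_left _ _ hN]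
  · rw [hM' f hf hfk, hM' _ (E.charFun p).2 (hp hk), mul_div_mul_left _ _ hM]

/-- The invariant measure for which `F(p)` has mass `1`. -/
noncomputable def haar (E : C1Str K V) (p : E.I) : E.mu :=
  -- The index chosen for `f` may be replaced by any `i ≤ p` under which `f` is invariant;
  -- additivity then uses one index for `f`, `g` and `f + g`.
  have key : ∀ (f : E.D) (i : E.I), i ≤ p → (∀ w ∈ E.F i, ∀ v, f.1 (v + w) = f.1 v) →
      E.cosetSum (E.exists_invariance_index p f).choose f.1 /
        E.cosetSum (E.exists_invariance_index p f).choose (E.charFun p).1 =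
      E.cosetSum i f.1 / E.cosetSum i (E.charFun p).1 := fun f i hi hfi =>
    E.cosetSum_div_eq (E.exists_invariance_index p f).choose_spec.1 hi f.2
      (E.exists_invariance_index p f).choose_spec.2 hfi
  ⟨{ toFun := fun f => E.cosetSum (E.exists_invariance_index p f).choose f.1 /
        E.cosetSum (E.exists_invariance_index p f).choose (E.charFun p).1
     map_add' := fun f g => by
      obtain ⟨i, hi, hfi⟩ := E.exists_invariance_index p f
      obtain ⟨j, hj, hgj⟩ := E.exists_invariance_index p g
      obtain ⟨k, hki, hkj⟩ := E.exists_le i j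
      have h1 : ∀ w ∈ E.F k, ∀ v, f.1 (v + w) = f.1 v := fun w hw => hfi w (E.mono hki hw)
      have h2 : ∀ w ∈ E.F k, ∀ v, g.1 (v + w) = g.1 v := fun w hw => hgj w (E.mono hkj hw)
      rw [key f k (hki.trans hi) h1, key g k (hki.trans hi) h2, key (f + g) k (hki.trans hi)
        fun w hw v => congrArg₂ (· + ·) (h1 w hw v) (h2 w hw v), ← add_div,
        ← E.cosetSum_add k f.2 g.2]
      rfl
     map_smul' := fun c f => by
      obtain ⟨i, hi, hfi⟩ := E.exists_invariance_index p f
      rw [key f i hi hfi, key (c • f) i hi fun w hw v => congrArg (c * ·) (hfi w hw v),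
        RingHom.id_apply, smul_eq_mul, ← mul_div_assoc, ← E.cosetSum_smul]
      rfl },
    fun a f => by
      obtain ⟨i, hi, hfi⟩ := E.exists_invariance_index p f
      refine (key _ i hi fun w hw v => ?_).trans (Eq.trans ?_ (key f i hi hfi).symm)
      · change f.1 (v + w + a) = f.1 (v + a)
        rw [add_right_comm, hfi w hw]
      · exact congrArg (· / _) (E.cosetSum_translate i a f.1 hfi)⟩

theorem mass_haar (E : C1Str K V) (p : E.I) : mass (E.haar p) p = 1 :=
  div_self (E.cosetSum_charFun_ne_zero (E.exists_invariance_index p (E.charFun p)).choose_spec.1)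

/-- A function invariant under `F(i)` is a combination of translates of `δ_{F(i)}`. -/
theorem integral_eq_cosetSum_mul_mass (E : C1Str K V) (m : E.mu) (i : E.I) (f : E.D)
    (hi : ∀ w ∈ E.F i, ∀ v, f.1 (v + w) = f.1 v) : m.1 f = E.cosetSum i f.1 * mass m i := by
  obtain ⟨_, j, _, hf, _⟩ := f.2
  obtain ⟨j', hij', hjj'⟩ := E.exists_ge i j
  have hfin := E.finite_coset_support hij' fun v hv => hf v fun hv' => hv (E.mono hjj' hv')
  have h1 : f = ∑ q ∈ hfin.toFinset, f.1 q.out • E.translate (-q.out) (E.charFun i) := by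
    ext v
    have h2 : (∑ q ∈ hfin.toFinset, f.1 q.out • E.translate (-q.out) (E.charFun i)).1 v =
        ∑ q ∈ hfin.toFinset, f.1 q.out * (E.charFun i).1 (v + -q.out) := by
      rw [Submodule.coe_sum, Finset.sum_apply]
      rfl
    have h4 : ∀ q : V ⧸ E.F i, v - q.out ∈ E.F i ↔ q = Submodule.Quotient.mk v := fun q => by
      rw [← Submodule.Quotient.eq, eq_comm]
      exact Eq.congr_left (Quotient.out_eq q)
    rw [h2, Finset.sum_eq_single (Submodule.Quotient.mk v)]
    · rw [E.apply_out hi, ← sub_eq_add_neg]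
      have h3 : (E.charFun i).1 (v - (Submodule.Quotient.mk v : V ⧸ E.F i).out) = 1 :=
        Set.indicator_of_mem ((h4 _).2 rfl) _
      rw [h3, mul_one]
    · intro q _ hq
      rw [← sub_eq_add_neg]
      have h3 : (E.charFun i).1 (v - q.out) = 0 :=
        Set.indicator_of_notMem (fun h => hq ((h4 _).1 h)) _
      rw [h3, mul_zero]
    · intro hq
      rw [Set.Finite.mem_toFinset, Function.notMem_support] at hq
      rw [hq, zero_mul]
  conv_lhs => rw [h1]
  rw [map_sum]
  unfold cosetSum
  rw [finsum_eq_sum _ hfin, Finset.sum_mul]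
  refine Finset.sum_congr rfl fun q _ => ?_
  rw [map_smul, m.2, smul_eq_mul]
  rfl

theorem mass_of_le (E : C1Str K V) (m : E.mu) {i p : E.I} (h : i ≤ p) :
    mass m p = Nat.card (SubQ (E.F i) (E.F p)) * mass m i := by
  rw [← E.cosetSum_charFun h]
  exact E.integral_eq_cosetSum_mul_mass m i _ fun w hw => E.charFun_add p w (E.mono h hw)

/-- The integral of an `F(i)`-invariant function depends only on the mass of `F(i)`, and for `i ≤ p`
the mass of `F(p)` is a nonzero multiple of it. -/
theorem mu_ext (E : C1Str K V) {m m' : E.mu} (p : E.I) (h : mass m p = mass m' p) : m = m' := by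
  ext f
  obtain ⟨i, hi, hfi⟩ := E.exists_invariance_index p f
  rw [E.integral_eq_cosetSum_mul_mass m i f hfi, E.integral_eq_cosetSum_mul_mass m' i f hfi]
  congr 1
  have := E.finite_subQ hi
  have h0 : (Nat.card (SubQ (E.F i) (E.F p)) : ℂ) ≠ 0 := by exact_mod_cast Nat.card_pos.ne'
  rw [E.mass_of_le m hi, E.mass_of_le m' hi] at h
  exact mul_left_cancel₀ h0 h

/-- The space of invariant measures is one-dimensional. -/
theorem exists_eq_smul (E : C1Str K V) {m : E.mu} (hm : m ≠ 0) (m' : E.mu) :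
    ∃ c : ℂ, m' = c • m := by
  obtain ⟨p, _⟩ := E.exists_mem 0
  have h0 : mass m p ≠ 0 := fun h => hm (E.mu_ext p h)
  exact ⟨mass m' p / mass m p, E.mu_ext p (div_mul_cancel₀ _ h0).symm⟩

/-- The pairing `μ(F(p)) μ'(F(p)^⊥)` of `μ(E)` and `μ(Ě)` does not depend on `p`. -/
theorem mass_mul_mass_dual (E : C1Str K V) (c : E.mu) (c' : E.dual.mu) (p q : E.I) :
    mass c p * mass c' (OrderDual.toDual p) = mass c q * mass c' (OrderDual.toDual q) := by
  -- Passing from `p` to `q` multiplies the mass of `F(p)` by an index and divides that of `F(p)^⊥`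
  -- by the same number, by `card_dual_subQ`.
  have key : ∀ {p q : E.I}, p ≤ q →
      mass c p * mass c' (OrderDual.toDual p) = mass c q * mass c' (OrderDual.toDual q) := by
    intro p q h
    have h1 : mass c' (OrderDual.toDual p) = _ :=
      E.dual.mass_of_le c' (i := OrderDual.toDual q) (p := OrderDual.toDual p) h
    rw [h1, E.mass_of_le c h, E.card_dual_subQ h]
    ring
  obtain ⟨k, hp, hq⟩ := E.exists_le p q
  exact (key hp).symm.trans (key hq)

end C1Str

/-! ### The characteristic function of a compact subspace with discrete quotient. -/

namespace C1Str

variable {K V V₁ V₂ V₃ : Type u} [Field K] [AddCommGroup V] [Module K V]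
  [AddCommGroup V₁] [Module K V₁] [AddCommGroup V₂] [Module K V₂]
  [AddCommGroup V₃] [Module K V₃]

theorem exists_integral_one_eq_one [Finite K] (E : C1Str K V) (h : E.IsCompact) :
    ∃ m : E.mu, m.1 (E.one h) = 1 := by
  have h1 := h
  obtain ⟨i, hi⟩ := h1
  refine ⟨E.haar i, (congrArg (E.haar i).1 (Subtype.ext (funext fun v => ?_))).trans
    (E.mass_haar i)⟩
  exact (Set.indicator_of_mem (by rw [hi]; trivial) _).symm

theorem exists_integral_deltaZero_eq_one [Finite K] (E : C1Str K V) (h : E.IsDiscrete) :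
    ∃ m : E.mu, m.1 (E.deltaZero h) = 1 := by
  have h1 := h
  obtain ⟨i, hi⟩ := h1
  refine ⟨E.haar i, (congrArg (E.haar i).1 (Subtype.ext ?_)).trans (E.mass_haar i)⟩
  change Set.indicator {0} 1 = Set.indicator (E.F i : Set V) 1
  rw [hi, Submodule.bot_coe]

theorem deltaZero_zero (E : C1Str K V) (h : E.IsDiscrete) : (E.deltaZero h).1 0 = 1 :=
  Set.indicator_of_mem (Set.mem_singleton 0) _

theorem deltaZero_of_ne (E : C1Str K V) (h : E.IsDiscrete) {v : V} (hv : v ≠ 0) :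
    (E.deltaZero h).1 v = 0 :=
  Set.indicator_of_notMem (s := {0}) hv _

/-- An invariant measure kills a function that a translation multiplies by a scalar `≠ 1`. -/
theorem integral_eq_zero_of_translate (E : C1Str K V) (m : E.mu) (f : E.D) (a : V) (c : ℂ)
    (hc : c ≠ 1) (hf : E.translate a f = c • f) : m.1 f = 0 := by
  have h2 := m.2 a f
  rw [hf, map_smul, smul_eq_mul] at h2
  by_contra h3
  exact hc (mul_right_cancel₀ h3 (by rw [h2, one_mul]))

section Triple

variable {E₁ : C1Str K V₁} {E₂ : C1Str K V₂} {E₃ : C1Str K V₃}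
  {α : V₁ →ₗ[K] V₂} {β : V₂ →ₗ[K] V₃}

/-- The characteristic function of `V₁` in `V₂`, where `E₁` is compact and `E₃` is discrete. -/
noncomputable def charRange (h : IsAdmissible E₁ E₂ E₃ α β) (hc : E₁.IsCompact)
    (hd : E₃.IsDiscrete) : E₂.D :=
  extendZero h hd (E₁.one hc)

theorem charRange_of_eq_zero (h : IsAdmissible E₁ E₂ E₃ α β) (hc : E₁.IsCompact)
    (hd : E₃.IsDiscrete) {v : V₂} (hv : β v = 0) : (charRange h hc hd).1 v = 1 := by
  obtain ⟨x, rfl⟩ := (h.exact v).1 hv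
  exact h.inj.extend_apply _ _ _

theorem charRange_of_ne_zero (h : IsAdmissible E₁ E₂ E₃ α β) (hc : E₁.IsCompact)
    (hd : E₃.IsDiscrete) {v : V₂} (hv : β v ≠ 0) : (charRange h hc hd).1 v = 0 :=
  Function.extend_apply' _ _ _ fun ⟨x, hx⟩ => hv ((h.exact v).2 ⟨x, hx⟩)

/-- A fibre of `β` is either the image of `V₁` or disjoint from it. -/
theorem push_charRange (h : IsAdmissible E₁ E₂ E₃ α β) (hc : E₁.IsCompact)
    (hd : E₃.IsDiscrete) (m : E₁.mu) :
    push h m (charRange h hc hd) = m.1 (E₁.one hc) • E₃.deltaZero hd := by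
  ext w
  obtain ⟨x, rfl⟩ := h.surj w
  rw [push_apply]
  change _ = m.1 (E₁.one hc) * (E₃.deltaZero hd).1 (β x)
  have hβ : ∀ v, β (α v + x) = β x := fun v => by
    rw [map_add, (h.exact (α v)).2 ⟨v, rfl⟩, zero_add]
  by_cases hx : β x = 0
  · rw [hx, deltaZero_zero, mul_one]
    congr 1
    ext v
    exact charRange_of_eq_zero h hc hd ((hβ v).trans hx)
  · rw [deltaZero_of_ne _ _ hx, mul_zero]
    have h1 : pull h (E₂.translate x (charRange h hc hd)) = 0 := by
      ext v
      exact charRange_of_ne_zero h hc hd fun h0 => hx ((hβ v).symm.trans h0)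
    rw [h1, map_zero]

theorem prod_charRange (h : IsAdmissible E₁ E₂ E₃ α β) (hc : E₁.IsCompact)
    (hd : E₃.IsDiscrete) (m₁ : E₁.mu) (m₃ : E₃.mu) :
    (prod h m₁ m₃).1 (charRange h hc hd) = m₁.1 (E₁.one hc) * m₃.1 (E₃.deltaZero hd) := by
  rw [prod_apply, push_charRange, map_smul, smul_eq_mul]

/-- Orthogonality of characters. If `w` vanishes on `V₁`, the character is `1` there and the
integral is `m(V₁)`. Otherwise some translation by an element of `V₁` multiplies the integrand by a
scalar `≠ 1`, so the integral is zero. -/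
theorem fourier_charRange (ψ : AddChar K ℂ) (hψ : ψ ≠ 1) (h : IsAdmissible E₁ E₂ E₃ α β)
    (hc : E₁.IsCompact) (hd : E₃.IsDiscrete) (m : E₂.mu) :
    fourier ψ hψ E₂ (charRange h hc hd) m =
      m.1 (charRange h hc hd) • charRange h.dual hd.dual hc.dual := by
  ext w
  change m.1 (E₂.mulChar ψ w (charRange h hc hd)) =
    m.1 (charRange h hc hd) * (charRange h.dual hd.dual hc.dual).1 w
  by_cases hw : dualMap h.isMor_left w = 0
  · rw [charRange_of_eq_zero h.dual hd.dual hc.dual hw, mul_one]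
    congr 1
    ext v
    change (charRange h hc hd).1 v * starRingEnd ℂ (ψ (w.1 v)) = _
    by_cases hv : β v = 0
    · obtain ⟨x, rfl⟩ := (h.exact v).1 hv
      have h1 : w.1 (α x) = 0 := congrArg (fun u : E₁.dualSpace => u.1 x) hw
      rw [h1, AddChar.map_zero_eq_one, map_one, mul_one]
    · rw [charRange_of_ne_zero h hc hd hv, zero_mul]
  · rw [charRange_of_ne_zero h.dual hd.dual hc.dual hw, mul_zero]
    obtain ⟨x, hx⟩ : ∃ x, w.1 (α x) ≠ 0 := by
      by_contra hcon
      push Not at hcon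
      exact hw (Subtype.ext (LinearMap.ext hcon))
    obtain ⟨c, hc'⟩ : ∃ c, ψ c ≠ 1 := by
      by_contra hcon
      push Not at hcon
      exact hψ (DFunLike.ext _ _ hcon)
    -- `ψ` may be trivial at `w (α x)` itself; rescaling `x` gives `w` the value `c`, where `ψ c ≠
    -- 1`.
    have hy : w.1 (α ((c / w.1 (α x)) • x)) = c := by
      rw [map_smul, map_smul, smul_eq_mul, div_mul_cancel₀ _ hx]
    set y := (c / w.1 (α x)) • x
    refine integral_eq_zero_of_translate E₂ m _ (α y) (starRingEnd ℂ (ψ c)) (fun h0 => hc' ?_) ?_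
    · have h1 := congrArg (starRingEnd ℂ) h0
      rwa [Complex.conj_conj, map_one] at h1
    · ext v
      change (charRange h hc hd).1 (v + α y) * starRingEnd ℂ (ψ (w.1 (v + α y))) =
        starRingEnd ℂ (ψ c) * ((charRange h hc hd).1 v * starRingEnd ℂ (ψ (w.1 v)))
      have h1 : (charRange h hc hd).1 (v + α y) = (charRange h hc hd).1 v := by
        have h2 : β (v + α y) = β v := by
          rw [map_add, (h.exact (α y)).2 ⟨y, rfl⟩, add_zero]
        by_cases hv : β v = 0
        · rw [charRange_of_eq_zero h hc hd hv, charRange_of_eq_zero h hc hd (h2.trans hv)]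
        · rw [charRange_of_ne_zero h hc hd hv,
            charRange_of_ne_zero h hc hd fun h3 => hv (h2.symm.trans h3)]
      rw [h1, map_add, hy, AddChar.map_add_eq_mul, map_mul]
      ring

variable [Finite K]

theorem exists_integral_charRange_eq_one (h : IsAdmissible E₁ E₂ E₃ α β) (hc : E₁.IsCompact)
    (hd : E₃.IsDiscrete) : ∃ m : E₂.mu, m.1 (charRange h hc hd) = 1 := by
  obtain ⟨m₁, h₁⟩ := E₁.exists_integral_one_eq_one hc
  obtain ⟨m₃, h₃⟩ := E₃.exists_integral_deltaZero_eq_one hd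
  exact ⟨prod h m₁ m₃, by rw [prod_charRange, h₁, h₃, mul_one]⟩

/-- `μ(E₂)` is a line, and the product of the two normalised measures is nonzero since it gives `V₁`
the mass `1`. -/
theorem exists_eq_prod (h : IsAdmissible E₁ E₂ E₃ α β) (hc : E₁.IsCompact)
    (hd : E₃.IsDiscrete) (m : E₂.mu) : ∃ m₁ m₃, m = prod h m₁ m₃ := by
  obtain ⟨m₁, h₁⟩ := E₁.exists_integral_one_eq_one hc
  obtain ⟨m₃, h₃⟩ := E₃.exists_integral_deltaZero_eq_one hd
  have h0 : prod h m₁ m₃ ≠ 0 := fun h0 => by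
    have h1 := prod_charRange h hc hd m₁ m₃
    rw [h0, h₁, h₃, mul_one] at h1
    exact zero_ne_one h1
  obtain ⟨c, rfl⟩ := E₂.exists_eq_smul h0 m
  exact ⟨c • m₁, m₃, (LinearMap.map_smul₂ (prod h) c m₁ m₃).symm⟩

/-- The pairing may be computed at an index with `F(i) = V` and `F(i)^⊥ = 0`, where the
characteristic functions are `1` and `δ₀`. The discrete case below uses `F(i) = 0` instead. -/
theorem integral_one_mul_integral_deltaZero (E : C1Str K V) (hc : E.IsCompact) (c : E.mu)
    (c' : E.dual.mu) (p : E.I) :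
    c.1 (E.one hc) * c'.1 (E.dual.deltaZero hc.dual) =
      mass c p * mass c' (OrderDual.toDual p) := by
  have h1 := hc
  obtain ⟨i, hi⟩ := h1
  rw [E.mass_mul_mass_dual c c' p i]
  congr 1
  · refine congrArg c.1 (Subtype.ext (funext fun v => ?_))
    exact (Set.indicator_of_mem (by rw [hi]; trivial) _).symm
  · have h2 : (E.dual.F (OrderDual.toDual i) : Set E.dualSpace) = {0} := by
      ext w
      refine (E.mem_dual_F i w).trans ?_
      rw [hi]
      constructor
      · exact fun h => Subtype.ext (LinearMap.ext fun v => h v trivial)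
      · rintro rfl v _
        rfl
    refine congrArg c'.1 (Subtype.ext ?_)
    change Set.indicator {0} 1 = Set.indicator (E.dual.F (OrderDual.toDual i) : Set E.dualSpace) 1
    rw [h2]

theorem integral_deltaZero_mul_integral_one (E : C1Str K V) (hd : E.IsDiscrete) (c : E.mu)
    (c' : E.dual.mu) (p : E.I) :
    c.1 (E.deltaZero hd) * c'.1 (E.dual.one hd.dual) =
      mass c p * mass c' (OrderDual.toDual p) := by
  have h1 := hd
  obtain ⟨i, hi⟩ := h1
  rw [E.mass_mul_mass_dual c c' p i]
  congr 1
  · refine congrArg c.1 (Subtype.ext ?_)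
    change Set.indicator {0} 1 = Set.indicator (E.F i : Set V) 1
    rw [hi, Submodule.bot_coe]
  · refine congrArg c'.1 (Subtype.ext (funext fun w => ?_))
    refine (Set.indicator_of_mem ((E.mem_dual_F i w).2 fun x hx => ?_) _).symm
    rw [hi, Submodule.mem_bot] at hx
    rw [hx, map_zero]

/-- The functionals `c ↦ c(V₁)` on `μ(E₂)` and `c' ↦ c'(V₁^⊥)` on `μ(Ě₂)` are inverse to each
other. -/
theorem integral_charRange_mul_dual (h : IsAdmissible E₁ E₂ E₃ α β) (hc : E₁.IsCompact)
    (hd : E₃.IsDiscrete) (c : E₂.mu) (c' : E₂.dual.mu) (p : E₂.I) :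
    c.1 (charRange h hc hd) * c'.1 (charRange h.dual hd.dual hc.dual) =
      mass c p * mass c' (OrderDual.toDual p) := by
  obtain ⟨ε, hε, _⟩ := h.dom₁
  obtain ⟨γ, hγ, _⟩ := h.dom₃
  -- Both sides are multiplicative along the triple, so writing both measures as products reduces
  -- the identity to `E₁` and `E₃`. In the dual triple the two factors change places.
  obtain ⟨m₁, m₃, rfl⟩ := exists_eq_prod h hc hd c
  obtain ⟨n₃, n₁, rfl⟩ := exists_eq_prod h.dual hd.dual hc.dual c'
  have h1 : E₃.dual.F (OrderDual.toDual (γ p)) =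
      (E₂.dual.F (OrderDual.toDual p)).comap (dualMap h.isMor_right) := by
    ext u
    refine (mem_dual_F E₃ (γ p) u).trans (Iff.trans ?_ (mem_dual_F E₂ p _).symm)
    rw [hγ]
    simp [dualMap_apply]
  have h2 : E₁.dual.F (OrderDual.toDual (ε p)) =
      (E₂.dual.F (OrderDual.toDual p)).map (dualMap h.isMor_left) := by
    ext u
    refine (mem_dual_F E₁ (ε p) u).trans ?_
    rw [hε]
    constructor
    · intro hu
      obtain ⟨w, hw⟩ := h.exists_extension p u.1 hu
      exact ⟨w.1, w.2, Subtype.ext hw⟩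
    · rintro ⟨w, hw, rfl⟩ x hx
      exact (mem_dual_F E₂ p w).1 hw _ hx
  have key : ∀ a₁ a₃ b₁ b₃ x₁ x₃ y₁ y₃ : ℂ, a₁ * b₁ = x₁ * y₁ → a₃ * b₃ = x₃ * y₃ →
      a₁ * a₃ * (b₃ * b₁) = x₁ * x₃ * (y₃ * y₁) := by
    intro a₁ a₃ b₁ b₃ x₁ x₃ y₁ y₃ h₁ h₃
    linear_combination a₃ * b₃ * h₁ + x₁ * y₁ * h₃
  refine (congrArg₂ (· * ·) (prod_charRange h hc hd m₁ m₃)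
    (prod_charRange h.dual hd.dual hc.dual n₃ n₁)).trans (Eq.trans ?_
    (congrArg₂ (· * ·) (mass_prod h m₁ m₃ p _ _ (hε p) (hγ p))
      (mass_prod h.dual n₃ n₁ (OrderDual.toDual p) _ _ h1 h2)).symm)
  exact key _ _ _ _ _ _ _ _ (E₁.integral_one_mul_integral_deltaZero hc m₁ n₁ (ε p))
    (E₃.integral_deltaZero_mul_integral_one hd m₃ n₃ (γ p))

end Triple

end C1Str

/-! ### Evaluation of maps defined as inverses or by graphs. -/

theorem linInv_apply {A B : Type*} [AddCommMonoid A] [Module ℂ A] [AddCommMonoid B]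
    [Module ℂ B] {f : A →ₗ[ℂ] B} (hf : Function.Bijective f) {x : A} {y : B} (h : f x = y) :
    linInv f y = x := by
  rw [linInv, dif_pos hf, ← h]
  exact (LinearEquiv.ofBijective f hf).symm_apply_apply x

/-- `ofGraph` is zero unless `R` is functional on all of `A`, so `hR` is needed at every `x` even to
evaluate at one. -/
theorem ofGraph_apply {A B : Type*} [AddCommMonoid A] [Module ℂ A] [AddCommMonoid B]
    [Module ℂ B] {R : Submodule ℂ (A × B)} (hR : ∀ x, ∃! y, (x, y) ∈ R) {x : A} {y : B}
    (h : (x, y) ∈ R) : ofGraph R x = y := by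
  have hbij : Function.Bijective (LinearMap.fst ℂ A B ∘ₗ R.subtype) := by
    constructor
    · rintro ⟨⟨a, b⟩, hab⟩ ⟨⟨a', b'⟩, hab'⟩ (rfl : a = a')
      rw [Subtype.mk.injEq, (hR a).unique hab hab']
    · intro a
      obtain ⟨b, hb, _⟩ := hR a
      exact ⟨⟨(a, b), hb⟩, rfl⟩
  exact congrArg (fun z : R => z.1.2) (linInv_apply hbij (x := ⟨(x, y), h⟩) (y := x) rfl)

/-! ### Unit families and the virtual measures they determine. -/

namespace C1System

variable {K : Type u} [Field K]

/-- The value of a virtual measure on the measure `x ∈ μ(F(k)/F(n))`. -/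
noncomputable def vmApply {S : C1System K} {k l n : S.I} (m : S.VM k l) (hk : n ≤ k) (hl : n ≤ l)
    (x : (S.E hk).mu) : (S.E hl).mu :=
  (show S.vm k l from m).1 ⟨n, hk, hl⟩ x

theorem vm_ext {S : C1System K} {k l : S.I} {m m' : S.VM k l}
    (h : ∀ n (hk : n ≤ k) (hl : n ≤ l) (x : (S.E hk).mu),
      vmApply m hk hl x = vmApply m' hk hl x) : m = m' :=
  Subtype.ext (funext fun n => LinearMap.ext fun x => h n.1 n.2.1 n.2.2 x)

theorem vmApply_smul {S : C1System K} {k l n : S.I} (m : S.VM k l) (hk : n ≤ k) (hl : n ≤ l)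
    (c : ℂ) (x : (S.E hk).mu) : vmApply m hk hl (c • x) = c • vmApply m hk hl x :=
  LinearMap.map_smul ((show S.vm k l from m).1 ⟨n, hk, hl⟩) c x

theorem smul_vmApply {S : C1System K} {k l n : S.I} (m : S.VM k l) (hk : n ≤ k) (hl : n ≤ l)
    (c : ℂ) (x : (S.E hk).mu) : vmApply (c • m) hk hl x = c • vmApply m hk hl x :=
  rfl

theorem vmApply_mprod {S : C1System K} {k l n n' : S.I} (m : S.VM k l) (hk : n ≤ k) (hl : n ≤ l)
    (h : n' ≤ n) (c : (S.E h).mu) (x : (S.E hk).mu) :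
    vmApply m (h.trans hk) (h.trans hl) (S.mprod h hk c x) =
      S.mprod h hl c (vmApply m hk hl x) :=
  (show S.vm k l from m).2 ⟨n, hk, hl⟩ ⟨n', h.trans hk, h.trans hl⟩ h c x

theorem vmApply_vmul {S : C1System K} {l j o n : S.I} (h : l ≤ j) (a : (S.E h).mu)
    (m : S.VM j o) (hl : n ≤ l) (ho : n ≤ o) (x : (S.E hl).mu) :
    vmApply (S.vmul h o a m) hl ho x = vmApply m (hl.trans h) ho (S.mprod hl h x a) :=
  rfl

/-- A family of functions on the spaces `F(j)/F(i)`, compatible with restriction and with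
integration over the fibres, on which some invariant measure takes the value `1`. -/
structure UnitFamily (S : C1System K) where
  e : ∀ {i j : S.I} (h : i ≤ j), (S.E h).D
  pull_e : ∀ {i j k : S.I} (h : i ≤ j) (h' : j ≤ k),
    C1Str.pull (S.adm h h') (e (h.trans h')) = e h
  push_e : ∀ {i j k : S.I} (h : i ≤ j) (h' : j ≤ k) (c : (S.E h).mu),
    C1Str.push (S.adm h h') c (e (h.trans h')) = c.1 (e h) • e h'
  exists_one : ∀ {i j : S.I} (h : i ≤ j), ∃ m : (S.E h).mu, m.1 (e h) = 1

namespace UnitFamily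

variable {S : C1System K} (N : S.UnitFamily)

/-- The value of an invariant measure on the given function. -/
noncomputable def val {i j : S.I} (h : i ≤ j) (m : (S.E h).mu) : ℂ := m.1 (N.e h)

theorem val_smul {i j : S.I} (h : i ≤ j) (c : ℂ) (m : (S.E h).mu) :
    N.val h (c • m) = c * N.val h m := rfl

/-- The invariant measure with value `1` on the given function. -/
noncomputable def unit {i j : S.I} (h : i ≤ j) : (S.E h).mu := (N.exists_one h).choose

theorem val_unit {i j : S.I} (h : i ≤ j) : N.val h (N.unit h) = 1 :=
  (N.exists_one h).choose_spec

theorem unit_ne_zero {i j : S.I} (h : i ≤ j) : N.unit h ≠ 0 := fun h0 => by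
  have h1 := N.val_unit h
  rw [h0] at h1
  exact zero_ne_one h1

/-- The condition `push_e` is designed for this: the coordinates `N.val` on the lines of measures
respect products, so later identities of measures become identities of numbers. -/
theorem val_mprod {i j k : S.I} (h : i ≤ j) (h' : j ≤ k) (c : (S.E h).mu) (a : (S.E h').mu) :
    N.val (h.trans h') (S.mprod h h' c a) = N.val h c * N.val h' a := by
  unfold val
  rw [mprod, C1Str.prod_apply, N.push_e, map_smul, smul_eq_mul]

/-- The function `e` as an element of `D(F(j)/F(i))`. -/
noncomputable def eFn {i j : S.I} (h : i ≤ j) : S.Fn h := N.e h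

/-- The measure `unit` as an element of `μ(F(j)/F(i))`. -/
noncomputable def unitMs {i j : S.I} (h : i ≤ j) : S.Ms h := N.unit h

theorem fnPull_e {l j i : S.I} (h : l ≤ j) (h' : j ≤ i) :
    S.fnPull h h' (N.eFn (h.trans h')) = N.eFn h :=
  N.pull_e h h'

theorem fnPush_e {l j i : S.I} (h : l ≤ j) (h' : j ≤ i) :
    S.fnPush h h' (N.eFn (h.trans h')) (N.unitMs h) = N.eFn h' := by
  refine (N.push_e h h' (N.unit h)).trans ?_
  refine (congrArg (· • N.e h') (N.val_unit h)).trans ?_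
  exact one_smul ℂ (N.e h')

variable [Finite K]

theorem eq_smul_unit {i j : S.I} (h : i ≤ j) (m : (S.E h).mu) :
    m = N.val h m • N.unit h := by
  obtain ⟨c, rfl⟩ := (S.E h).exists_eq_smul (N.unit_ne_zero h) m
  rw [val_smul, val_unit, mul_one]

theorem mu_ext {i j : S.I} (h : i ≤ j) {m m' : (S.E h).mu} (hm : N.val h m = N.val h m') :
    m = m' := by
  rw [N.eq_smul_unit h m, N.eq_smul_unit h m', hm]

/-- The virtual measure that preserves the value on the given functions. -/
noncomputable def virt (k l : S.I) : S.VM k l :=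
  (show S.vm k l from ⟨fun n =>
    { toFun := fun x => N.val n.2.1 x • N.unit n.2.2
      map_add' := fun x y => add_smul _ _ _
      map_smul' := fun c x => mul_smul _ _ _ },
    -- Compatibility between levels: both measures have the value `N.val c * N.val a`.
    fun n n' h c a => N.mu_ext (h.trans n.2.2) (by
      change N.val (h.trans n.2.2) (N.val (h.trans n.2.1) (S.mprod h n.2.1 c a) •
          N.unit (h.trans n.2.2)) =
        N.val (h.trans n.2.2) (S.mprod h n.2.2 c (N.val n.2.1 a • N.unit n.2.2))
      rw [val_smul, val_unit, val_mprod, val_mprod, val_smul, val_unit, mul_one, mul_one])⟩)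

theorem val_virt (k l : S.I) {n : S.I} (hk : n ≤ k) (hl : n ≤ l) (x : (S.E hk).mu) :
    N.val hl (vmApply (N.virt k l) hk hl x) = N.val hk x := by
  change N.val hl (N.val hk x • N.unit hl) = _
  rw [val_smul, val_unit, mul_one]

theorem eq_virt {k l : S.I} (m : S.VM k l)
    (hm : ∀ n (hk : n ≤ k) (hl : n ≤ l) (x : (S.E hk).mu),
      N.val hl (vmApply m hk hl x) = N.val hk x) : m = N.virt k l :=
  vm_ext fun n hk hl x => N.mu_ext hl ((hm n hk hl x).trans (N.val_virt k l hk hl x).symm)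

/-- A product of unit measures is a unit measure, so the scalar relating `m` to `virt` can be read
off at any level. -/
theorem val_vmApply_of_le {k l : S.I} (m : S.VM k l) {n n' : S.I} (hk : n ≤ k) (hl : n ≤ l)
    (h : n' ≤ n) :
    N.val (h.trans hl) (vmApply m (h.trans hk) (h.trans hl) (N.unit (h.trans hk))) =
      N.val hl (vmApply m hk hl (N.unit hk)) := by
  have h1 : N.unit (h.trans hk) = S.mprod h hk (N.unit h) (N.unit hk) :=
    N.mu_ext _ (by rw [val_mprod, val_unit, val_unit, val_unit, mul_one])
  rw [h1, vmApply_mprod, val_mprod, val_unit, one_mul]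

theorem val_vmApply {k l n : S.I} (m : S.VM k l) (hk : n ≤ k) (hl : n ≤ l) (x : (S.E hk).mu) :
    N.val hl (vmApply m hk hl x) = N.val hl (vmApply m hk hl (N.unit hk)) * N.val hk x := by
  have h := vmApply_smul m hk hl (N.val hk x) (N.unit hk)
  rw [← N.eq_smul_unit hk x] at h
  rw [h, val_smul, mul_comm]

/-- The space of virtual measures is spanned by the given one. -/
theorem exists_eq_smul_virt (hdir : ∀ i j : S.I, ∃ k, k ≤ i ∧ k ≤ j) {k l : S.I} (m : S.VM k l) :
    ∃ c : ℂ, m = c • N.virt k l := by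
  obtain ⟨n, hnk, hnl⟩ := hdir k l
  refine ⟨N.val hnl (vmApply m hnk hnl (N.unit hnk)), vm_ext fun n' hk hl x => N.mu_ext hl ?_⟩
  -- The scalars at `n` and `n'` are compared at a common lower level.
  obtain ⟨p, hp, hp'⟩ := hdir n n'
  rw [val_vmApply, smul_vmApply, val_smul, val_virt, ← N.val_vmApply_of_le m hk hl hp',
    ← N.val_vmApply_of_le m hnk hnl hp]

/-- A common lower bound of `k` and `l` ensures that virtual measures have a component at all, where
`virt` is nonzero. -/
theorem virt_smul_injective (hdir : ∀ i j : S.I, ∃ k, k ≤ i ∧ k ≤ j) {k l : S.I} {c c' : ℂ}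
    (h : c • N.virt k l = c' • N.virt k l) : c = c' := by
  obtain ⟨n, hnk, hnl⟩ := hdir k l
  have h1 := congrArg (fun m => N.val hnl (vmApply m hnk hnl (N.unit hnk))) h
  simp only [smul_vmApply, val_smul, val_virt, val_unit, mul_one] at h1
  exact h1

theorem vmul_unit_virt {l j : S.I} (h : l ≤ j) (o : S.I) :
    S.vmul h o (N.unitMs h) (N.virt j o) = N.virt l o :=
  N.eq_virt _ fun n hk hl x => by
    rw [unitMs, vmApply_vmul, val_virt, val_mprod, val_unit, mul_one]

/-- The space `μ(F(j)/F(i))` is spanned by the given measure. -/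
theorem exists_eq_smul_unit {i j : S.I} (h : i ≤ j) (a : S.Ms h) :
    ∃ c : ℂ, a = c • N.unitMs h :=
  ⟨_, N.eq_smul_unit h a⟩

theorem lift_vmul_unit_virt {l j : S.I} (h : l ≤ j) (o : S.I) :
    TensorProduct.lift (S.vmul h o) (N.unitMs h ⊗ₜ[ℂ] N.virt j o) = N.virt l o := by
  rw [TensorProduct.lift.tmul, N.vmul_unit_virt h o]

/-- Both sides are lines and a generator goes to a generator. Without bijectivity the `linInv` in
`splitVm` would be zero. -/
theorem lift_vmul_bijective (N : S.UnitFamily) (hdir : ∀ i j : S.I, ∃ k, k ≤ i ∧ k ≤ j) {l j : S.I} (h : l ≤ j)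
    (o : S.I) : Function.Bijective (TensorProduct.lift (S.vmul h o)) := by
  have hspan : ∀ x : S.Ms h ⊗[ℂ] S.VM j o, ∃ c : ℂ, x = c • (N.unitMs h ⊗ₜ[ℂ] N.virt j o) := by
    intro x
    induction x using TensorProduct.induction_on with
    | zero => exact ⟨0, (zero_smul ℂ _).symm⟩
    | tmul a m =>
      obtain ⟨c, rfl⟩ := N.exists_eq_smul_virt hdir m
      obtain ⟨d, rfl⟩ := N.exists_eq_smul_unit h a
      exact ⟨d * c, TensorProduct.smul_tmul_smul _ _ _ _⟩
    | add x y hx hy =>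
      obtain ⟨c, rfl⟩ := hx
      obtain ⟨d, rfl⟩ := hy
      exact ⟨c + d, (add_smul c d _).symm⟩
  constructor
  · intro x y hxy
    obtain ⟨c, rfl⟩ := hspan x
    obtain ⟨d, rfl⟩ := hspan y
    rw [map_smul, map_smul, lift_vmul_unit_virt] at hxy
    rw [N.virt_smul_injective hdir hxy]
  · intro m
    obtain ⟨c, rfl⟩ := N.exists_eq_smul_virt hdir m
    exact ⟨c • (N.unitMs h ⊗ₜ[ℂ] N.virt j o), by rw [map_smul, lift_vmul_unit_virt]⟩

theorem splitVm_virt (hdir : ∀ i j : S.I, ∃ k, k ≤ i ∧ k ≤ j) (o : S.I) {l j : S.I} (h : l ≤ j)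
    (M : Type u) [AddCommGroup M] [Module ℂ M] (f : M) :
    S.splitVm o h M (f ⊗ₜ[ℂ] N.virt l o) = (f ⊗ₜ[ℂ] N.unitMs h) ⊗ₜ[ℂ] N.virt j o := by
  rw [splitVm, LinearMap.comp_apply, LinearMap.lTensor_tmul,
    linInv_apply (N.lift_vmul_bijective hdir h o) (N.lift_vmul_unit_virt h o)]
  rfl

/-- The element with the components `e ⊗ v`, where `v` is the virtual measure that preserves the
value on the functions `e`. -/
noncomputable def elt (o : S.I) : ∀ p, S.Comp o p := fun p => N.eFn p.2 ⊗ₜ[ℂ] N.virt p.1.1 o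

/-- Restriction acts on `e` alone. For integration, `virt l o` splits as the unit measure times
`virt j o`, and the fibre integral of `e` against the unit measure is `e` again. -/
theorem elt_mem_limD (hdir : ∀ i j : S.I, ∃ k, k ≤ i ∧ k ≤ j) (o : S.I) :
    N.elt o ∈ S.limD o := by
  intro l j i h h'
  constructor
  · change S.compPull o h h' (N.eFn (h.trans h') ⊗ₜ[ℂ] N.virt l o) = N.eFn h ⊗ₜ[ℂ] N.virt l o
    rw [compPull, TensorProduct.map_tmul, N.fnPull_e]
    rfl
  · change S.compPush o h h' (N.eFn (h.trans h') ⊗ₜ[ℂ] N.virt l o) = N.eFn h' ⊗ₜ[ℂ] N.virt j o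
    rw [compPush, LinearMap.comp_apply, N.splitVm_virt hdir, TensorProduct.map_tmul,
      TensorProduct.lift.tmul, N.fnPush_e]
    rfl

end UnitFamily

end C1System

/-! ### The families `1` and `δ₀`; duality of virtual measures. -/

namespace C1System

variable {K : Type u} [Field K]

section Finite

variable [Finite K]

/-- The functions `1` on the spaces `F(j)/F(i)` of a system of compact `C₁`-spaces. -/
noncomputable def oneFamily (S : C1System K) (hS : S.IsCf) : S.UnitFamily where
  e h := C1Str.one _ (hS h)
  pull_e _ _ := rfl
  push_e h h' c := by
    ext w
    obtain ⟨y, rfl⟩ := (S.adm h h').surj w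
    rw [C1Str.push_apply]
    exact (mul_one _).symm
  exists_one h := C1Str.exists_integral_one_eq_one _ (hS h)

/-- The functions `δ₀` on the spaces `F(j)/F(i)` of a system of discrete `C₁`-spaces. -/
noncomputable def deltaFamily (S : C1System K) (hS : S.IsDf) : S.UnitFamily where
  e h := C1Str.deltaZero _ (hS h)
  pull_e h h' := by
    ext x
    change (C1Str.deltaZero _ (hS (h.trans h'))).1 (S.ι h h' x) = (C1Str.deltaZero _ (hS h)).1 x
    by_cases hx : x = 0
    · rw [hx, map_zero, C1Str.deltaZero_zero, C1Str.deltaZero_zero]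
    · rw [C1Str.deltaZero_of_ne _ _ hx, C1Str.deltaZero_of_ne]
      exact fun h0 => hx ((S.adm h h').inj (h0.trans (map_zero _).symm))
  push_e h h' c := by
    ext w
    obtain ⟨y, rfl⟩ := (S.adm h h').surj w
    change _ = c.1 (C1Str.deltaZero _ (hS h)) * (C1Str.deltaZero _ (hS h')).1 (S.ρ h h' y)
    by_cases hy : S.ρ h h' y = 0
    -- Over `0` the representative `y` comes from `v` in the subspace, and the invariance of `c`
    -- removes the translation by `v`.
    · obtain ⟨v, rfl⟩ := ((S.adm h h').exact y).1 hy
      rw [hy, C1Str.deltaZero_zero, mul_one, ← hy, C1Str.push_apply, C1Str.pull_translate, c.2]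
      congr 1
      ext x
      change (C1Str.deltaZero _ (hS (h.trans h'))).1 (S.ι h h' x) =
        (C1Str.deltaZero _ (hS h)).1 x
      by_cases hx : x = 0
      · rw [hx, map_zero, C1Str.deltaZero_zero, C1Str.deltaZero_zero]
      · rw [C1Str.deltaZero_of_ne _ _ hx, C1Str.deltaZero_of_ne]
        exact fun h0 => hx ((S.adm h h').inj (h0.trans (map_zero _).symm))
    · rw [C1Str.deltaZero_of_ne _ _ hy, mul_zero, C1Str.push_apply]
      have h1 : C1Str.pull (S.adm h h') ((S.E (h.trans h')).translate y
          (C1Str.deltaZero _ (hS (h.trans h')))) = 0 := by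
        ext x
        refine C1Str.deltaZero_of_ne (S.E (h.trans h')) (hS _) fun h0 => hy ?_
        have h2 : S.ρ h h' (S.ι h h' x + y) = S.ρ h h' 0 := congrArg (S.ρ h h') h0
        rwa [map_add, map_zero, ((S.adm h h').exact _).2 ⟨x, rfl⟩, zero_add] at h2
      rw [h1, map_zero]
  exists_one h := C1Str.exists_integral_deltaZero_eq_one _ (hS h)

/-- `virt` shows that the condition under `Classical.epsilon` is satisfiable, and `eq_virt` that it
has only one solution. -/
theorem vmOne_eq (S : C1System K) (hS : S.IsCf) (k l : S.I) :
    S.vmOne hS k l = (S.oneFamily hS).virt k l :=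
  (S.oneFamily hS).eq_virt _ fun n hk hl x =>
    Classical.epsilon_spec
      (p := fun m : S.vm k l => ∀ n x, (m.1 n x).1 (C1Str.one _ (hS n.2.2)) =
        x.1 (C1Str.one _ (hS n.2.1)))
      ⟨(S.oneFamily hS).virt k l, fun n x =>
        (S.oneFamily hS).val_virt k l n.2.1 n.2.2 x⟩ ⟨n, hk, hl⟩ x

theorem vmDelta_eq (S : C1System K) (hS : S.IsDf) (k l : S.I) :
    S.vmDelta hS k l = (S.deltaFamily hS).virt k l :=
  (S.deltaFamily hS).eq_virt _ fun n hk hl x =>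
    Classical.epsilon_spec
      (p := fun m : S.vm k l => ∀ n x, (m.1 n x).1 (C1Str.deltaZero _ (hS n.2.2)) =
        x.1 (C1Str.deltaZero _ (hS n.2.1)))
      ⟨(S.deltaFamily hS).virt k l, fun n x =>
        (S.deltaFamily hS).val_virt k l n.2.1 n.2.2 x⟩ ⟨n, hk, hl⟩ x

theorem oneElt_eq (S : C1System K) (hS : S.IsCf) (o : S.I) :
    S.oneElt hS o = (S.oneFamily hS).elt o :=
  funext fun p => congrArg (fun m => S.fnOne hS p.2 ⊗ₜ[ℂ] m) (S.vmOne_eq hS p.1.1 o)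

end Finite

theorem oneElt_mem_limD [Finite K] (S : C1System K) (hdir : ∀ i j : S.I, ∃ k, k ≤ i ∧ k ≤ j)
    (hS : S.IsCf) (o : S.I) : S.oneElt hS o ∈ S.limD o := by
  rw [S.oneElt_eq hS]
  exact (S.oneFamily hS).elt_mem_limD hdir o

/-- The graph `vmDualGraph` as a space of pairs of virtual measures. -/
def vmDualRel (S : C1System K) (l n : S.I) :
    Submodule ℂ (S.VM l n × S.dual.VM (S.op l) (S.op n)) :=
  S.vmDualGraph l n

theorem mem_vmDualRel {S : C1System K} {l n : S.I} {x : S.VM l n}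
    {y : S.dual.VM (S.op l) (S.op n)} : (x, y) ∈ S.vmDualRel l n ↔
    ∀ (k k' : S.I) (hkl : k ≤ l) (hkn : k ≤ n) (hl : l ≤ k') (hn : n ≤ k')
    (a : (S.E hkl).mu) (c : (S.E hl).mu) (c' : (S.E hl).dual.mu) (d : (S.E hn).mu)
    (p : (S.E hl).I) (q : (S.E hn).I),
    (C1Str.mass c p * C1Str.mass c' (OrderDual.toDual p)) •
        S.mprod hkn hn (vmApply x hkl hkn a) d =
      (C1Str.mass d q * C1Str.mass (E := (S.E hn).dual)
        (vmApply y (S.op_le hl) (S.op_le hn) c') (OrderDual.toDual q)) • S.mprod hkl hl a c :=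
  Iff.rfl

section Dual

variable [Finite K] {S : C1System K} (N : S.UnitFamily) (N' : S.dual.UnitFamily)

/-- The families `N` and `N'` are inverse to each other with respect to the pairing of `μ(E)` and
`μ(Ě)`. -/
def UnitFamily.IsInverse : Prop :=
  ∀ {i j : S.I} (h : i ≤ j) (c : (S.E h).mu) (c' : (S.E h).dual.mu) (p : (S.E h).I),
    C1Str.mass c p * C1Str.mass c' (OrderDual.toDual p) = N.val h c * N'.val (S.op_le h) c'

variable {N N'}

/-- Applying the injective coordinate `N.val` turns the relation between measures into one between
numbers. Inverse families turn the pairings into products of values, so `p` and `q` disappear. -/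
theorem mem_vmDualRel_iff (hN : N.IsInverse N') {l n : S.I} {x : S.VM l n}
    {y : S.dual.VM (S.op l) (S.op n)} : (x, y) ∈ S.vmDualRel l n ↔
    ∀ (k k' : S.I) (hkl : k ≤ l) (hkn : k ≤ n) (hl : l ≤ k') (hn : n ≤ k')
    (a : (S.E hkl).mu) (c : (S.E hl).mu) (c' : (S.E hl).dual.mu) (d : (S.E hn).mu),
    N.val hl c * N'.val (S.op_le hl) c' *
        (N.val hkn (vmApply x hkl hkn a) * N.val hn d) =
      N.val hn d * N'.val (S.op_le hn) (vmApply y (S.op_le hl) (S.op_le hn) c') *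
        (N.val hkl a * N.val hl c) := by
  rw [mem_vmDualRel]
  refine forall_congr' fun k => forall_congr' fun k' => forall_congr' fun hkl =>
    forall_congr' fun hkn => forall_congr' fun hl => forall_congr' fun hn =>
    forall_congr' fun a => forall_congr' fun c => forall_congr' fun c' => forall_congr' fun d => ?_
  have key : ∀ p q, N.val (hkn.trans hn)
      ((C1Str.mass c p * C1Str.mass c' (OrderDual.toDual p)) •
        S.mprod hkn hn (vmApply x hkl hkn a) d) =
      N.val hl c * N'.val (S.op_le hl) c' * (N.val hkn (vmApply x hkl hkn a) * N.val hn d) ∧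
      N.val (hkl.trans hl) ((C1Str.mass d q * C1Str.mass (E := (S.E hn).dual)
        (vmApply y (S.op_le hl) (S.op_le hn) c') (OrderDual.toDual q)) • S.mprod hkl hl a c) =
      N.val hn d * N'.val (S.op_le hn) (vmApply y (S.op_le hl) (S.op_le hn) c') *
        (N.val hkl a * N.val hl c) := fun p q =>
    ⟨(N.val_smul _ _ _).trans (congrArg₂ (· * ·) (hN hl c c' p) (N.val_mprod hkn hn _ d)),
      (N.val_smul _ _ _).trans (congrArg₂ (· * ·)
        (hN hn d (vmApply y (S.op_le hl) (S.op_le hn) c') q) (N.val_mprod hkl hl a c))⟩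
  constructor
  · intro h
    obtain ⟨p, _⟩ := (S.E hl).exists_mem 0
    obtain ⟨q, _⟩ := (S.E hn).exists_mem 0
    exact (key p q).1.symm.trans ((congrArg (N.val (hkl.trans hl)) (h p q)).trans (key p q).2)
  · intro h p q
    exact N.mu_ext (hkl.trans hl) ((key p q).1.trans (h.trans (key p q).2.symm))

theorem virt_mem_vmDualRel (hN : N.IsInverse N') (l n : S.I) :
    (N.virt l n, N'.virt (S.op l) (S.op n)) ∈ S.vmDualRel l n := by
  rw [mem_vmDualRel_iff hN]
  intro k k' hkl hkn hl hn a c c' d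
  rw [N.val_virt, N'.val_virt (S.op l) (S.op n) (S.op_le hl) (S.op_le hn) c']
  ring

/-- With unit measures for `a`, `c` and `d`, the relation expresses the value of `y` on `c'` through
`x` and `c'`. The level `k` below `l` and `n` exists by directedness; `k'` is the level of the
component of `y`. -/
theorem vmDualRel_unique (hdir : ∀ i j : S.I, ∃ k, k ≤ i ∧ k ≤ j) (hN : N.IsInverse N')
    {l n : S.I} {x : S.VM l n} {y y' : S.dual.VM (S.op l) (S.op n)}
    (hy : (x, y) ∈ S.vmDualRel l n) (hy' : (x, y') ∈ S.vmDualRel l n) : y = y' := by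
  rw [mem_vmDualRel_iff hN] at hy hy'
  obtain ⟨k, hkl, hkn⟩ := hdir l n
  have key : ∀ (k' : S.I) (hl : l ≤ k') (hn : n ≤ k') (c' : (S.E hl).dual.mu),
      N'.val (S.op_le hn) (vmApply y (S.op_le hl) (S.op_le hn) c') =
        N'.val (S.op_le hn) (vmApply y' (S.op_le hl) (S.op_le hn) c') := by
    intro k' hl hn c'
    have h1 := (hy k k' hkl hkn hl hn (N.unit hkl) (N.unit hl) c' (N.unit hn)).symm.trans
      (hy' k k' hkl hkn hl hn (N.unit hkl) (N.unit hl) c' (N.unit hn))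
    rwa [N.val_unit hkl, N.val_unit hl, N.val_unit hn, one_mul, one_mul, mul_one, mul_one,
      one_mul] at h1
  exact vm_ext fun k' hl hn c' => N'.mu_ext hn (key k' hl hn c')

/-- The isomorphism `vmDual` sends the virtual measure of a family to that of the inverse
family. -/
theorem vmDual_virt (hdir : ∀ i j : S.I, ∃ k, k ≤ i ∧ k ≤ j) (hN : N.IsInverse N') (l n : S.I) :
    S.vmDual l n (N.virt l n) = N'.virt (S.op l) (S.op n) := by
  refine ofGraph_apply (R := S.vmDualRel l n) (fun x => ?_) (virt_mem_vmDualRel hN l n)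
  -- The relation has to be functional on the whole line; every `x` is a multiple of `virt`, whose
  -- partner is known.
  obtain ⟨c, rfl⟩ := N.exists_eq_smul_virt hdir x
  have h1 := (S.vmDualRel l n).smul_mem c (virt_mem_vmDualRel hN l n)
  exact ⟨_, h1, fun y hy => vmDualRel_unique hdir hN hy h1⟩

end Dual

end C1System

/-! ### The unit family of an admissible triple and the Poisson formula. -/

namespace C1SysTriple

variable {K : Type u} [Field K]

open C1System

/-- The characteristic function of `F₁(ε(j))/F₁(ε(i))` in `F₂(j)/F₂(i)`. -/
noncomputable def chr (T : C1SysTriple K) (h₁ : T.S₁.IsCf) (h₃ : T.S₃.IsDf) {i j : T.S₂.I}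
    (h : i ≤ j) : (T.S₂.E h).D :=
  C1Str.charRange (T.adm h) (h₁ (T.ε.monotone h)) (h₃ (T.γ.monotone h))

theorem chr_congr (T : C1SysTriple K) (h₁ : T.S₁.IsCf) (h₃ : T.S₃.IsDf) {i j k l : T.S₂.I}
    (h : i ≤ j) (h' : k ≤ l) {x : T.S₂.Q h} {y : T.S₂.Q h'} (hxy : T.b h x = 0 ↔ T.b h' y = 0) :
    (T.chr h₁ h₃ h).1 x = (T.chr h₁ h₃ h').1 y := by
  by_cases hx : T.b h x = 0
  · exact (C1Str.charRange_of_eq_zero _ _ _ hx).trans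
      (C1Str.charRange_of_eq_zero _ _ _ (hxy.1 hx)).symm
  · exact (C1Str.charRange_of_ne_zero _ _ _ hx).trans
      (C1Str.charRange_of_ne_zero _ _ _ fun h => hx (hxy.2 h)).symm

/-- Membership in `V₁` is tested by `b`, and the inclusions of the third system are injective. -/
theorem pull_chr (T : C1SysTriple K) (h₁ : T.S₁.IsCf) (h₃ : T.S₃.IsDf) {i j k : T.S₂.I}
    (h : i ≤ j) (h' : j ≤ k) :
    C1Str.pull (T.S₂.adm h h') (T.chr h₁ h₃ (h.trans h')) = T.chr h₁ h₃ h := by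
  ext x
  refine T.chr_congr h₁ h₃ (h.trans h') h ?_
  rw [T.b_ι]
  exact map_eq_zero_iff _ (T.S₃.adm (T.γ.monotone h) (T.γ.monotone h')).inj

/-- A fibre over a point of the subspace meets the subspace in a translate of its part in
`F₂(j)/F₂(i)`, of measure `c.1 (chr h)`; the other fibres do not meet it. -/
theorem push_chr (T : C1SysTriple K) (h₁ : T.S₁.IsCf) (h₃ : T.S₃.IsDf) {i j k : T.S₂.I}
    (h : i ≤ j) (h' : j ≤ k) (c : (T.S₂.E h).mu) :
    C1Str.push (T.S₂.adm h h') c (T.chr h₁ h₃ (h.trans h')) =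
      c.1 (T.chr h₁ h₃ h) • T.chr h₁ h₃ h' := by
  ext w
  obtain ⟨y, rfl⟩ := (T.S₂.adm h h').surj w
  rw [C1Str.push_apply]
  change _ = c.1 (T.chr h₁ h₃ h) * (T.chr h₁ h₃ h').1 (T.S₂.ρ h h' y)
  by_cases hy : T.b h' (T.S₂.ρ h h' y) = 0
  · have h5 : (T.chr h₁ h₃ h').1 (T.S₂.ρ h h' y) = 1 := C1Str.charRange_of_eq_zero _ _ _ hy
    rw [h5, mul_one]
    rw [T.b_ρ] at hy
    -- The image of `y` in the third system comes from the smaller quotient. A lift `z` of it turns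
    -- the translation by `y` into one inside `F₂(j)/F₂(i)`, which `c` ignores.
    obtain ⟨t, ht⟩ := ((T.S₃.adm (T.γ.monotone h) (T.γ.monotone h')).exact _).1 hy
    obtain ⟨z, rfl⟩ := (T.adm h).surj t
    rw [← c.2 z (T.chr h₁ h₃ h)]
    congr 1
    ext x
    refine T.chr_congr h₁ h₃ (h.trans h') h (x := T.S₂.ι h h' x + y) (y := x + z) ?_
    have h2 : T.b (h.trans h') (T.S₂.ι h h' x + y) =
        T.S₃.ι (T.γ.monotone h) (T.γ.monotone h') (T.b h (x + z)) := by
      rw [map_add, T.b_ι, ← ht, map_add, map_add]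
    rw [h2]
    exact map_eq_zero_iff _ (T.S₃.adm (T.γ.monotone h) (T.γ.monotone h')).inj
  · have h5 : (T.chr h₁ h₃ h').1 (T.S₂.ρ h h' y) = 0 := C1Str.charRange_of_ne_zero _ _ _ hy
    rw [h5, mul_zero]
    have h1 : C1Str.pull (T.S₂.adm h h') ((T.S₂.E (h.trans h')).translate y
        (T.chr h₁ h₃ (h.trans h'))) = 0 := by
      ext x
      refine C1Str.charRange_of_ne_zero (T.adm (h.trans h')) (h₁ _) (h₃ _) fun h0 => hy ?_
      have h2 : T.S₂.ρ h h' (T.S₂.ι h h' x) = 0 := ((T.S₂.adm h h').exact _).2 ⟨x, rfl⟩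
      rw [← zero_add (T.S₂.ρ h h' y), ← h2, ← map_add, T.b_ρ, h0, map_zero]
    rw [h1, map_zero]

/-- The graph `vmProdGraph` as a space of pairs of virtual measures. -/
def vmProdRel (T : C1SysTriple K) (i j : T.S₂.I) (m₃ : T.S₃.VM (T.γ i) (T.γ j)) :
    Submodule ℂ (T.S₁.VM (T.ε i) (T.ε j) × T.S₂.VM i j) :=
  T.vmProdGraph i j m₃

theorem mem_vmProdRel {T : C1SysTriple K} {i j : T.S₂.I} {m₃ : T.S₃.VM (T.γ i) (T.γ j)}
    {x : T.S₁.VM (T.ε i) (T.ε j)} {y : T.S₂.VM i j} : (x, y) ∈ T.vmProdRel i j m₃ ↔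
    ∀ (n : T.S₂.I) (hi : n ≤ i) (hj : n ≤ j)
    (a : (T.S₁.E (T.ε.monotone hi)).mu) (b : (T.S₃.E (T.γ.monotone hi)).mu),
    vmApply y hi hj (C1Str.prod (T.adm hi) a b) =
      C1Str.prod (T.adm hj) (vmApply x (T.ε.monotone hi) (T.ε.monotone hj) a)
        (vmApply m₃ (T.γ.monotone hi) (T.γ.monotone hj) b) :=
  Iff.rfl

variable [Finite K]

/-- The characteristic functions of the subspaces `F₁(ε(j))/F₁(ε(i))` of `F₂(j)/F₂(i)`. -/
noncomputable def family (T : C1SysTriple K) (h₁ : T.S₁.IsCf) (h₃ : T.S₃.IsDf) :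
    T.S₂.UnitFamily where
  e h := T.chr h₁ h₃ h
  pull_e h h' := T.pull_chr h₁ h₃ h h'
  push_e h h' c := T.push_chr h₁ h₃ h h' c
  exists_one h := C1Str.exists_integral_charRange_eq_one (T.adm h) (h₁ _) (h₃ _)

theorem val_prod (T : C1SysTriple K) (h₁ : T.S₁.IsCf) (h₃ : T.S₃.IsDf) {i j : T.S₂.I}
    (h : i ≤ j) (x : (T.S₁.E (T.ε.monotone h)).mu) (y : (T.S₃.E (T.γ.monotone h)).mu) :
    (T.family h₁ h₃).val h (C1Str.prod (T.adm h) x y) =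
      (T.S₁.oneFamily h₁).val (T.ε.monotone h) x *
        (T.S₃.deltaFamily h₃).val (T.γ.monotone h) y :=
  C1Str.prod_charRange (T.adm h) (h₁ _) (h₃ _) x y

theorem virt_mem_vmProdRel (T : C1SysTriple K) (h₁ : T.S₁.IsCf) (h₃ : T.S₃.IsDf) (i j : T.S₂.I) :
    ((T.S₁.oneFamily h₁).virt (T.ε i) (T.ε j), (T.family h₁ h₃).virt i j) ∈
      T.vmProdRel i j ((T.S₃.deltaFamily h₃).virt (T.γ i) (T.γ j)) := by
  rw [mem_vmProdRel]
  intro n hi hj a b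
  apply (T.family h₁ h₃).mu_ext hj
  rw [UnitFamily.val_virt, val_prod, val_prod, UnitFamily.val_virt, UnitFamily.val_virt]

theorem vmProd_virt (T : C1SysTriple K) (hdir : ∀ i j : T.S₁.I, ∃ k, k ≤ i ∧ k ≤ j)
    (h₁ : T.S₁.IsCf) (h₃ : T.S₃.IsDf) (i j : T.S₂.I) :
    T.vmProd i j ((T.S₃.deltaFamily h₃).virt (T.γ i) (T.γ j))
      ((T.S₁.oneFamily h₁).virt (T.ε i) (T.ε j)) = (T.family h₁ h₃).virt i j := by
  have hmem := T.virt_mem_vmProdRel h₁ h₃ i j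
  refine ofGraph_apply (R := T.vmProdRel i j _) (fun x => ?_) hmem
  obtain ⟨c, rfl⟩ := (T.S₁.oneFamily h₁).exists_eq_smul_virt hdir x
  have hc := (T.vmProdRel i j _).smul_mem c hmem
  refine ⟨_, hc, fun y hy => vm_ext fun n hi hj z => ?_⟩
  -- The relation prescribes `y` on product measures only, and every measure is one; this gives
  -- uniqueness.
  obtain ⟨a, b, rfl⟩ := C1Str.exists_eq_prod (T.adm hi) (h₁ _) (h₃ _) z
  exact (mem_vmProdRel.1 hy n hi hj a b).trans (mem_vmProdRel.1 hc n hi hj a b).symm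

/-- The extension of `1` by zero is `chr` by definition, and the product of the
total-mass-preserving and the `{0}`-mass-preserving virtual measure preserves the mass of `V₁`. -/
theorem delta_eq (T : C1SysTriple K) (hdir : ∀ i j : T.S₁.I, ∃ k, k ≤ i ∧ k ≤ j)
    (h₁ : T.S₁.IsCf) (h₃ : T.S₃.IsDf) (o : T.S₂.I) :
    T.delta h₁ h₃ o = (T.family h₁ h₃).elt o := by
  funext p
  change TensorProduct.map (T.fnExtend h₃ p.2) (T.vmProd p.1.1 o
      (T.S₃.vmDelta h₃ (T.γ p.1.1) (T.γ o)))
    (T.S₁.fnOne h₁ (T.ε.monotone p.2) ⊗ₜ[ℂ] T.S₁.vmOne h₁ (T.ε p.1.1) (T.ε o)) = _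
  rw [TensorProduct.map_tmul, vmOne_eq, vmDelta_eq, T.vmProd_virt hdir]
  rfl

theorem family_isInverse (T : C1SysTriple K) (h₁ : T.S₁.IsCf) (h₃ : T.S₃.IsDf) :
    (T.family h₁ h₃).IsInverse (T.dual.family h₃.dual h₁.dual) := fun h c c' p =>
  (C1Str.integral_charRange_mul_dual (T.adm h) (h₁ (T.ε.monotone h)) (h₃ (T.γ.monotone h))
    c c' p).symm

theorem fnFourier_family (T : C1SysTriple K) (ψ : AddChar K ℂ) (hψ : ψ ≠ 1) (h₁ : T.S₁.IsCf)
    (h₃ : T.S₃.IsDf) {i j : T.S₂.I} (h : i ≤ j) :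
    T.S₂.fnFourier ψ hψ h ((T.family h₁ h₃).eFn h) ((T.family h₁ h₃).unitMs h) =
      (T.dual.family h₃.dual h₁.dual).eFn (T.S₂.op_le h) := by
  refine (C1Str.fourier_charRange ψ hψ (T.adm h) (h₁ (T.ε.monotone h)) (h₃ (T.γ.monotone h))
    ((T.family h₁ h₃).unit h)).trans ?_
  refine (congrArg (· • C1Str.charRange (T.adm h).dual _ _)
    ((T.family h₁ h₃).val_unit h)).trans ?_
  exact one_smul ℂ _

/-- Splitting `virt j o` supplies the unit measure on `F(i)/F(j)` for the Fourier transform and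
leaves `virt i o`, which `vmDual` carries to its dual counterpart. No scalar is left over. -/
theorem compFourier_elt (T : C1SysTriple K) (hdir : ∀ i j : T.S₂.I, ∃ k, k ≤ i ∧ k ≤ j)
    (ψ : AddChar K ℂ) (hψ : ψ ≠ 1) (h₁ : T.S₁.IsCf) (h₃ : T.S₃.IsDf) (o : T.S₂.I) {j i : T.S₂.I}
    (h : j ≤ i) :
    T.S₂.compFourier ψ hψ o h ((T.family h₁ h₃).eFn h ⊗ₜ[ℂ] (T.family h₁ h₃).virt j o) =
      UnitFamily.eFn (S := T.S₂.dual) (T.dual.family h₃.dual h₁.dual) (T.S₂.op_le h) ⊗ₜ[ℂ]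
        UnitFamily.virt (S := T.S₂.dual) (T.dual.family h₃.dual h₁.dual)
          (T.S₂.op i) (T.S₂.op o) := by
  rw [compFourier, LinearMap.comp_apply, UnitFamily.splitVm_virt _ hdir, TensorProduct.map_tmul,
    TensorProduct.lift.tmul, vmDual_virt hdir (T.family_isInverse h₁ h₃), fnFourier_family]
  rfl

theorem fourier_elt (T : C1SysTriple K) (hdir : ∀ i j : T.S₂.I, ∃ k, k ≤ i ∧ k ≤ j)
    (ψ : AddChar K ℂ) (hψ : ψ ≠ 1) (h₁ : T.S₁.IsCf) (h₃ : T.S₃.IsDf) (o : T.S₂.I) :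
    T.S₂.fourier ψ hψ o ((T.family h₁ h₃).elt o) =
      (T.dual.family h₃.dual h₁.dual).elt (T.S₂.op o) :=
  -- The two indices of `p` change places because the dual index set has the inverse order.
  funext fun p => T.compFourier_elt hdir ψ hψ h₁ h₃ o (j := p.1.2) (i := p.1.1) p.2

/-- The Poisson formula for a triple of systems of `C₁`-spaces. -/
theorem fourier_delta (T : C1SysTriple K) (hdir₁ : ∀ i j : T.S₁.I, ∃ k, k ≤ i ∧ k ≤ j)
    (hdir₂ : ∀ i j : T.S₂.I, ∃ k, k ≤ i ∧ k ≤ j)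
    (hdir₃ : ∀ i j : T.S₃.dual.I, ∃ k, k ≤ i ∧ k ≤ j)
    (ψ : AddChar K ℂ) (hψ : ψ ≠ 1) (h₁ : T.S₁.IsCf) (h₃ : T.S₃.IsDf) (o : T.S₂.I) :
    T.S₂.fourier ψ hψ o (T.delta h₁ h₃ o) = T.dual.delta h₃.dual h₁.dual (T.S₂.op o) :=
  (congrArg (T.S₂.fourier ψ hψ o) (T.delta_eq hdir₁ h₁ h₃ o)).trans
    ((T.fourier_elt hdir₂ ψ hψ h₁ h₃ o).trans
      (T.dual.delta_eq hdir₃ h₃.dual h₁.dual (T.S₂.op o)).symm)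

theorem delta_mem_limD (T : C1SysTriple K) (hdir₁ : ∀ i j : T.S₁.I, ∃ k, k ≤ i ∧ k ≤ j)
    (hdir₂ : ∀ i j : T.S₂.I, ∃ k, k ≤ i ∧ k ≤ j) (h₁ : T.S₁.IsCf) (h₃ : T.S₃.IsDf)
    (o : T.S₂.I) : T.delta h₁ h₃ o ∈ T.S₂.limD o := by
  rw [T.delta_eq hdir₁]
  exact (T.family h₁ h₃).elt_mem_limD hdir₂ o

end C1SysTriple

theorem mainTheorem2 {K : Type u} [Field K] [Finite K] (ψ : AddChar K ℂ) (hψ : ψ ≠ 1)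
    (E₁ E₂ E₃ : C2Space K) (α : E₁.V →ₗ[K] E₂.V) (β : E₂.V →ₗ[K] E₃.V)
    (ε : E₂.fil.I →o E₁.fil.I) (γ : E₂.fil.I →o E₃.fil.I)
    (h : C2Space.IsAdmissible E₁ E₂ E₃ α β ε γ)
    (hc₁ : E₁.IsComplete) (hc₂ : E₂.IsComplete) (hc₃ : E₃.IsComplete)
    (hcf : E₁.IsCf) (hdf : E₃.IsDf) (o : E₂.fil.I) :
    E₁.sys.oneElt hcf (ε o) ∈ E₁.sys.limD (ε o) ∧
    h.triple.delta hcf hdf o ∈ E₂.sys.limD o ∧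
    h.triple.dual.delta hdf.dual hcf.dual (E₂.sys.op o) ∈
      E₂.sys.dual.limD (E₂.sys.op o) ∧
    E₂.sys.fourier ψ hψ o (h.triple.delta hcf hdf o) =
      h.triple.dual.delta hdf.dual hcf.dual (E₂.sys.op o) := by
  have hlow : ∀ E : C2Space K, ∀ i j : E.sys.I, ∃ k, k ≤ i ∧ k ≤ j := fun E i j => by
    obtain ⟨k, _, h1, h2, _⟩ := E.fil.directed i j
    exact ⟨k, h1, h2⟩
  -- Lower bounds in the dual systems are upper bounds in the original filtrations. The dual triple
  -- starts with `Ě₃`, so they are needed for `E₃` as well as for `E₂`.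
  have hupp : ∀ E : C2Space K, ∀ i j : E.sys.dual.I, ∃ k, k ≤ i ∧ k ≤ j := fun E i j => by
    obtain ⟨_, k, _, _, h1, h2⟩ := E.fil.directed (OrderDual.ofDual i) (OrderDual.ofDual j)
    exact ⟨OrderDual.toDual k, h1, h2⟩
  exact ⟨E₁.sys.oneElt_mem_limD (hlow E₁) hcf (ε o),
    h.triple.delta_mem_limD (hlow E₁) (hlow E₂) hcf hdf o,
    h.triple.dual.delta_mem_limD (hupp E₃) (hupp E₂) hdf.dual hcf.dual (E₂.sys.op o),
    h.triple.fourier_delta (hlow E₁) (hlow E₂) (hupp E₃) ψ hψ hcf hdf o⟩
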